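/- Let $M$ be a smooth manifold of dimension $m$ (Hausdorff, second countable, without boundary), let $\Sigma\subset TM$ be a smooth distribution of rank $k$, and let $g_c$ be a smooth inner product on $\Sigma$. Let $TM=\Sigma\oplus\Sigma'$ be a splitting with $\Sigma'$ a smooth distribution, let $\mathcal P$ be the projection of $TM$ onto $\Sigma$ along $\Sigma'$, and let $g$ be an orthogonal extension of $g_c$, i.e. a smooth Riemannian metric on $M$ with $g|_{\Sigma}=g_c$ and $\Sigma\perp_g\Sigma'$. Denote by $\nabla$ the Levi-Civita connection and by $d\mathrm{vol}$ the Riemannian measure of $g$. For a smooth function $f$, the horizontal gradient $\nabla^{\mathcal H}f\in\Gamma(\Sigma)$ is defined by $g_c(\nabla^{\mathcal H}f,X)=Xf$ for all $X\in\Gamma(\Sigma)$. Let $D$ be the horizontal connection of the splitting, i.e. the unique connection on $\Sigma$ along horizontal vector fields such that $Xg_c(Y,Z)=g_c(D_XY,Z)+g_c(Y,D_XZ)$ and $D_XY-D_YX=\mathcal P[X,Y]$ for all $X,Y,Z\in\Gamma(\Sigma)$. Put $\mathrm{div}^{\mathcal H}X=\sum_{i=1}^k g_c(D_{X_i}X,X_i)$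 for $X\in\Gamma(\Sigma)$ and a local $g_c$-orthonormal basis $\{X_i\}$ of $\Sigma$, and $\Delta^{\mathcal H}=\mathrm{div}^{\mathcal H}\circ\nabla^{\mathcal H}$. The mean curvature of $\Sigma'$ is the horizontal vector field $\mathrm H^\bot=\sum_{\beta=1}^{m-k}\mathcal P(\nabla_{T_\beta}T_\beta)$, where $\{T_\beta\}$ is a local $g$-orthonormal basis of $\Sigma'$. Let $u$ be a positive smooth function on $M$ and set $d\mu=u\,d\mathrm{vol}$. Then $$-\int_M(\Delta^{\mathcal H}e)\,f\,d\mu=\int_M g_c(\nabla^{\mathcal H}e,\nabla^{\mathcal H}f)\,d\mu$$ holds for all smooth functions $e,f$ on $M$ with compact support if and only if $$\nabla^{\mathcal H}(\ln u)=\mathrm H^\bot\quad\text{on } M.$$ -/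

import Mathlib

open Set Filter Topology MeasureTheory Manifold
open scoped ContDiff

noncomputable section

namespace SubRiem

/-! ### Linear algebra: inner products given as bilinear forms -/

section LinearAlgebra

variable {V : Type*} [AddCommGroup V] [Module ℝ V]

/-- A symmetric positive definite bilinear form, i.e. an inner product. -/
structure IsInner (B : LinearMap.BilinForm ℝ V) : Prop where
  symm : ∀ v w, B v w = B w v
  pos : ∀ v, v ≠ 0 → 0 < B v v

theorem IsInner.nondegenerate {B : LinearMap.BilinForm ℝ V} (hB : IsInner B) :
    B.Nondegenerate := by
  have key : ∀ v, B v v = 0 → v = 0 := fun v hv => by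
    by_contra h
    exact (hB.pos v h).ne' hv
  exact ⟨fun v hv => key v (hv v), fun v hv => key v (hv v)⟩

theorem IsInner.exists_orthonormal_basis [FiniteDimensional ℝ V]
    {B : LinearMap.BilinForm ℝ V} (hB : IsInner B) :
    ∃ b : Module.Basis (Fin (Module.finrank ℝ V)) ℝ V,
      ∀ i j, B (b i) (b j) = if i = j then 1 else 0 := by
  let c : InnerProductSpace.Core ℝ V :=
    { inner := fun v w => B v w
      conj_inner_symm := fun v w => by simpa using hB.symm w v
      re_inner_nonneg := fun v => by
        by_cases h : v = 0
        · simp [h]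
        · simpa using (hB.pos v h).le
      add_left := fun u v w => by simp
      smul_left := fun u v r => by simp
      definite := fun v hv => by
        by_contra h
        exact (hB.pos v h).ne' hv }
  let _ : NormedAddCommGroup V := c.toNormedAddCommGroup
  let _ : InnerProductSpace ℝ V := InnerProductSpace.ofCore c.toCore
  refine ⟨(stdOrthonormalBasis ℝ V).toBasis, fun i j => ?_⟩
  rw [OrthonormalBasis.coe_toBasis]
  exact (orthonormal_iff_ite.mp (stdOrthonormalBasis ℝ V).orthonormal) i j

/-- An orthonormal basis of a finite-dimensional real vector space with an inner product. -/
def orthonormalBasis [FiniteDimensional ℝ V] {B : LinearMap.BilinForm ℝ V} (hB : IsInner B) :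
    Module.Basis (Fin (Module.finrank ℝ V)) ℝ V :=
  hB.exists_orthonormal_basis.choose

end LinearAlgebra

/-! ### Vector fields and Riemannian metrics on an `m`-dimensional smooth manifold -/

variable {m : ℕ} {M : Type*} [TopologicalSpace M] [ChartedSpace (EuclideanSpace ℝ (Fin m)) M]
  [IsManifold (𝓡 m) ∞ M]

instance (x : M) : FiniteDimensional ℝ (TangentSpace (𝓡 m) x) :=
  inferInstanceAs (FiniteDimensional ℝ (EuclideanSpace ℝ (Fin m)))

/-- The vector field `X` is smooth on the set `U`. -/
def SmoothFieldOn (X : ∀ x : M, TangentSpace (𝓡 m) x) (U : Set M) : Prop :=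
  ContMDiffOn (𝓡 m) (𝓡 m).tangent ∞
    (fun x => (⟨x, X x⟩ : TangentBundle (𝓡 m) M)) U

/-- A local vector field through the tangent vector `v` at `x`, smooth near `x`: it has constant
coefficients in the preferred chart at `x`. -/
def extendVector {x : M} (v : TangentSpace (𝓡 m) x) :
    ∀ y : M, TangentSpace (𝓡 m) y :=
  FiberBundle.extend (EuclideanSpace ℝ (Fin m)) v

variable (m M) in
/-- Smooth Riemannian metrics on `M`. -/
abbrev RiemannianMetricOn :=
  Bundle.ContMDiffRiemannianMetric (𝓡 m) ∞ (EuclideanSpace ℝ (Fin m))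
    (fun x : M => TangentSpace (𝓡 m) x)

section Riemannian

variable (g : RiemannianMetricOn m M)

/-- The inner product of a Riemannian metric on a tangent space, as a bilinear form. -/
def metricForm (x : M) : LinearMap.BilinForm ℝ (TangentSpace (𝓡 m) x) :=
  LinearMap.mk₂ ℝ (fun v w => g.inner x v w) (by simp) (by simp) (by simp) (by simp)

theorem metricForm_isInner (x : M) : IsInner (metricForm g x) :=
  ⟨fun v w => g.symm x v w, fun v hv => g.pos x v hv⟩

theorem metricForm_restrict_isInner (x : M) (W : Submodule ℝ (TangentSpace (𝓡 m) x)) :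
    IsInner ((metricForm g x).restrict W) :=
  ⟨fun v w => g.symm x v w, fun v hv => g.pos x v (fun h => hv (Subtype.ext h))⟩

/-- The right-hand side of the Koszul formula for `g(∇_X Y, Z)`. -/
def koszul (X Y Z : ∀ x : M, TangentSpace (𝓡 m) x) (x : M) : ℝ :=
  (1 / 2) *
    (mvfderiv (𝓡 m) (fun y => metricForm g y (Y y) (Z y)) x (X x)
      + mvfderiv (𝓡 m) (fun y => metricForm g y (X y) (Z y)) x (Y x)
      - mvfderiv (𝓡 m) (fun y => metricForm g y (X y) (Y y)) x (Z x)
      + metricForm g x (VectorField.mlieBracket (𝓡 m) X Y x) (Z x)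
      - metricForm g x (VectorField.mlieBracket (𝓡 m) X Z x) (Y x)
      - metricForm g x (VectorField.mlieBracket (𝓡 m) Y Z x) (X x))

/-- If `D` is metric, `X g(Y, Z) = g(D_X Y, Z) + g(Y, D_X Z)`, and torsion-free,
`D_X Y - D_Y X = [X, Y]`, on a class `P` of vector fields (such as the smooth ones), then
`g(D_X Y, Z)` is given by `koszul`. -/
theorem eq_koszul
    (D : (∀ x : M, TangentSpace (𝓡 m) x) → (∀ x : M, TangentSpace (𝓡 m) x) →
      ∀ x : M, TangentSpace (𝓡 m) x)
    (P : (∀ x : M, TangentSpace (𝓡 m) x) → Prop)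
    (metric : ∀ X Y Z, P X → P Y → P Z → ∀ x,
      mvfderiv (𝓡 m) (fun y => metricForm g y (Y y) (Z y)) x (X x) =
        metricForm g x (D X Y x) (Z x) + metricForm g x (Y x) (D X Z x))
    (torsion : ∀ X Y, P X → P Y → ∀ x,
      D X Y x - D Y X x = VectorField.mlieBracket (𝓡 m) X Y x)
    (X Y Z : ∀ x : M, TangentSpace (𝓡 m) x) (hX : P X) (hY : P Y) (hZ : P Z) (x : M) :
    metricForm g x (D X Y x) (Z x) = koszul g X Y Z x := by
  have hs := (metricForm_isInner g x).symm
  rw [koszul, metric X Y Z hX hY hZ, metric Y X Z hY hX hZ, metric Z X Y hZ hX hY,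
    ← torsion X Y hX hY, ← torsion X Z hX hZ, ← torsion Y Z hY hZ]
  simp only [map_sub, LinearMap.sub_apply]
  rw [hs (Y x) (D X Z x), hs (X x) (D Y Z x), hs (X x) (D Z Y x)]
  ring

/-- The Levi-Civita connection of `g`, the unique metric torsion-free connection: the vector `∇_v Y` at `x`, whose components in an
orthonormal basis of the tangent space are given by the Koszul formula. -/
def leviCivita (Y : ∀ x : M, TangentSpace (𝓡 m) x) (x : M) (v : TangentSpace (𝓡 m) x) :
    TangentSpace (𝓡 m) x :=
  ∑ i, koszul g (extendVector v) Y
      (extendVector (orthonormalBasis (metricForm_isInner g x) i)) x •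
    orthonormalBasis (metricForm_isInner g x) i

/-- The Gram determinant `det (g(∂ᵢ, ∂ⱼ))` in the chart `φ` at the point with coordinates `y`,
where `∂ᵢ = d(φ⁻¹)(eᵢ)`. -/
def gramDet (φ : OpenPartialHomeomorph M (EuclideanSpace ℝ (Fin m)))
    (y : EuclideanSpace ℝ (Fin m)) : ℝ :=
  Matrix.det (Matrix.of fun i j : Fin m =>
    metricForm g (φ.symm y)
      (mfderiv (𝓡 m) (𝓡 m) φ.symm y (EuclideanSpace.single i (1 : ℝ)))
      (mfderiv (𝓡 m) (𝓡 m) φ.symm y (EuclideanSpace.single j (1 : ℝ))))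

/-- The Riemannian measure `√(det gᵢⱼ) dy` of the domain of the chart `φ`, as a measure on `M`
that vanishes off this domain. -/
def chartMeasure [MeasurableSpace M] (φ : OpenPartialHomeomorph M (EuclideanSpace ℝ (Fin m))) :
    Measure M :=
  Measure.map φ.symm
    ((volume.withDensity fun y => ENNReal.ofReal √(gramDet g φ y)).restrict φ.target)

/-- The Riemannian measure of `g`. The measures of the chart domains agree on overlaps by the
change of variables formula; their least upper bound is the measure on `M` obtained by gluing
them. -/
def riemannianMeasure [MeasurableSpace M] : Measure M :=
  ⨆ x : M, chartMeasure g (chartAt (EuclideanSpace ℝ (Fin m)) x)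

end Riemannian

/-! ### Sub-Riemannian structures -/

variable (m M) in
/-- A smooth distribution of rank `k`: a family of `k`-dimensional subspaces of the tangent spaces
which is locally spanned by smooth vector fields. -/
structure Distribution (k : ℕ) where
  fiber : ∀ x : M, Submodule ℝ (TangentSpace (𝓡 m) x)
  finrank_fiber : ∀ x, Module.finrank ℝ (fiber x) = k
  exists_frame : ∀ x, ∃ U : Set M, IsOpen U ∧ x ∈ U ∧
    ∃ X : Fin k → ∀ y : M, TangentSpace (𝓡 m) y,
      (∀ i, SmoothFieldOn (X i) U) ∧
      ∀ y ∈ U, Submodule.span ℝ (Set.range fun i => X i y) = fiber y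

variable (m M) in
/-- A sub-Riemannian structure of rank `k`: a smooth distribution (the horizontal bundle) with a
smooth inner product `gc` on it. -/
structure SubRiemannianStructure (k : ℕ) extends Distribution m M k where
  gc : ∀ x : M, LinearMap.BilinForm ℝ (fiber x)
  isInner_gc : ∀ x, IsInner (gc x)
  smooth_gc : ∀ (U : Set M), IsOpen U → ∀ X Y : ∀ x : M, fiber x,
    SmoothFieldOn (fun x => (X x : TangentSpace (𝓡 m) x)) U →
    SmoothFieldOn (fun x => (Y x : TangentSpace (𝓡 m) x)) U →
    ContMDiffOn (𝓡 m) 𝓘(ℝ, ℝ) ∞ (fun x => gc x (X x) (Y x)) U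

/-- The distributions `S` and `S'` form a splitting `TM = S ⊕ S'`. -/
def IsSplitting {k l : ℕ} (S : Distribution m M k) (S' : Distribution m M l) : Prop :=
  ∀ x, IsCompl (S.fiber x) (S'.fiber x)

/-- The Riemannian metric `g` extends the sub-Riemannian metric of `S`, and makes `S` and `S'`
orthogonal. -/
structure IsOrthogonalExtension {k l : ℕ}
    (S : SubRiemannianStructure m M k) (S' : Distribution m M l)
    (g : RiemannianMetricOn m M) : Prop where
  extends_gc : ∀ (x : M) (v w : S.fiber x),
    metricForm g x (v : TangentSpace (𝓡 m) x) (w : TangentSpace (𝓡 m) x) = S.gc x v w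
  orthogonal : ∀ (x : M), ∀ v ∈ S.fiber x, ∀ w ∈ S'.fiber x, metricForm g x v w = 0

section Horizontal

variable {k l : ℕ} (S : SubRiemannianStructure m M k) (S' : Distribution m M l)

/-- The horizontal gradient: the horizontal vector with `gc(∇ᴴf, v) = df(v)` for all horizontal
vectors `v`. -/
def horizontalGradient (f : M → ℝ) (x : M) : S.fiber x :=
  ((S.gc x).toDual (S.isInner_gc x).nondegenerate).symm
    ((mvfderiv (𝓡 m) f x).toLinearMap ∘ₗ (S.fiber x).subtype)

variable {S S'} (hS : IsSplitting S.toDistribution S')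

/-- The projection of tangent vectors on the horizontal bundle `S` along `S'`. -/
def projH (x : M) : TangentSpace (𝓡 m) x →ₗ[ℝ] S.fiber x :=
  (S.fiber x).projectionOnto (S'.fiber x) (hS x)

/-- The projection of tangent vectors on `S'` along the horizontal bundle `S`. -/
def projV (x : M) : TangentSpace (𝓡 m) x →ₗ[ℝ] S'.fiber x :=
  (S'.fiber x).projectionOnto (S.fiber x) (hS x).symm

/-- The horizontal component `[X, Y]ᴴ` of the Lie bracket of two horizontal vector fields. -/
def horizontalBracket (X Y : ∀ x : M, S.fiber x) (x : M) : S.fiber x :=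
  projH hS x (VectorField.mlieBracket (𝓡 m)
    (fun y => (X y : TangentSpace (𝓡 m) y)) (fun y => (Y y : TangentSpace (𝓡 m) y)) x)

/-- The right-hand side of the Koszul formula for `gc(D_X Y, Z)`, where `D` is the horizontal
connection. -/
def horizontalKoszul (X Y Z : ∀ x : M, S.fiber x) (x : M) : ℝ :=
  (1 / 2) *
    (mvfderiv (𝓡 m) (fun y => S.gc y (Y y) (Z y)) x (X x)
      + mvfderiv (𝓡 m) (fun y => S.gc y (X y) (Z y)) x (Y x)
      - mvfderiv (𝓡 m) (fun y => S.gc y (X y) (Y y)) x (Z x)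
      + S.gc x (horizontalBracket hS X Y x) (Z x)
      - S.gc x (horizontalBracket hS X Z x) (Y x)
      - S.gc x (horizontalBracket hS Y Z x) (X x))

/-- If `D` is metric, `X gc(Y, Z) = gc(D_X Y, Z) + gc(Y, D_X Z)`, and satisfies
`D_X Y - D_Y X = [X, Y]ᴴ`, on a class `P` of horizontal vector fields (such as the smooth ones),
then `gc(D_X Y, Z)` is given by `horizontalKoszul`. -/
theorem eq_horizontalKoszul (D : (∀ x : M, S.fiber x) → (∀ x : M, S.fiber x) → ∀ x : M, S.fiber x)
    (P : (∀ x : M, S.fiber x) → Prop)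
    (metric : ∀ X Y Z, P X → P Y → P Z → ∀ x,
      mvfderiv (𝓡 m) (fun y => S.gc y (Y y) (Z y)) x (X x) =
        S.gc x (D X Y x) (Z x) + S.gc x (Y x) (D X Z x))
    (torsion : ∀ X Y, P X → P Y → ∀ x, D X Y x - D Y X x = horizontalBracket hS X Y x)
    (X Y Z : ∀ x : M, S.fiber x) (hX : P X) (hY : P Y) (hZ : P Z) (x : M) :
    S.gc x (D X Y x) (Z x) = horizontalKoszul hS X Y Z x := by
  have hs := (S.isInner_gc x).symm
  rw [horizontalKoszul, metric X Y Z hX hY hZ, metric Y X Z hY hX hZ, metric Z X Y hZ hX hY,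
    ← torsion X Y hX hY, ← torsion X Z hX hZ, ← torsion Y Z hY hZ]
  simp only [map_sub, LinearMap.sub_apply]
  rw [hs (Y x) (D X Z x), hs (X x) (D Y Z x), hs (X x) (D Z Y x)]
  ring

/-- A local horizontal vector field through the horizontal vector `v`, smooth near `x`. -/
def extendH {x : M} (v : S.fiber x) : ∀ y : M, S.fiber y :=
  fun y => projH hS y (extendVector (v : TangentSpace (𝓡 m) x) y)

/-- A local section of `S'` through the vector `t`, smooth near `x`. -/
def extendV {x : M} (t : S'.fiber x) : ∀ y : M, S'.fiber y :=
  fun y => projV hS y (extendVector (t : TangentSpace (𝓡 m) x) y)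

/-- An orthonormal basis of the horizontal space at `x`. -/
def horizontalBasis (S : SubRiemannianStructure m M k) (x : M) :
    Module.Basis (Fin (Module.finrank ℝ (S.fiber x))) ℝ (S.fiber x) :=
  orthonormalBasis (S.isInner_gc x)

/-- The horizontal connection `D` of the splitting, the unique one with
`X gc(Y, Z) = gc(D_X Y, Z) + gc(Y, D_X Z)` and `D_X Y - D_Y X = [X, Y]ᴴ`: here the vector `D_v Y`
at `x`, whose components in an orthonormal basis are given by the Koszul formula. -/
def horizontalConnection (Y : ∀ x : M, S.fiber x) (x : M) (v : S.fiber x) : S.fiber x :=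
  ∑ i, horizontalKoszul hS (extendH hS v) Y (extendH hS (horizontalBasis S x i)) x •
    horizontalBasis S x i

/-- The horizontal divergence `∑ᵢ gc(D_{Xᵢ} Y, Xᵢ)`. -/
def horizontalDivergence (Y : ∀ x : M, S.fiber x) (x : M) : ℝ :=
  ∑ i, S.gc x (horizontalConnection hS Y x (horizontalBasis S x i)) (horizontalBasis S x i)

/-- The horizontal Laplacian `Δᴴ = divᴴ ∘ ∇ᴴ`. -/
def horizontalLaplacian (f : M → ℝ) (x : M) : ℝ :=
  horizontalDivergence hS (horizontalGradient S f) x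

/-- The mean curvature `∑ᵦ P(∇_{Tᵦ} Tᵦ)` of `S'`, where the `Tᵦ` are sections of `S'` which form
an orthonormal basis at the point considered. The horizontal part of `∇_T T'` at a point depends
only on the values of the sections `T`, `T'` of `S'` at this point. -/
def meanCurvature (g : RiemannianMetricOn m M) (x : M) : S.fiber x :=
  ∑ β, projH hS x
    (leviCivita g
      (fun y => (extendV hS
        (orthonormalBasis (metricForm_restrict_isInner g x (S'.fiber x)) β) y :
          TangentSpace (𝓡 m) y)) x
      (orthonormalBasis (metricForm_restrict_isInner g x (S'.fiber x)) β : S'.fiber x))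

end Horizontal

end SubRiem

end

/-! The Riemannian divergence of a field `Y` is half the trace of `L_Y g`. For horizontal `Y` this
trace splits along `Σ ⊕ Σ'`. On `Σ`, the Koszul formula for `g_c(D_X Y, X)` collapses to `(1/2)(L_Y
g)(X, X)`, so the horizontal half is `div^H Y`. On `Σ'`, the Koszul formula for `g(∇_T T, Y)` with
`T ⊥ Y` collapses to `-(1/2)(L_Y g)(T, T)`, so the other half is `-g_c(H^⊥, Y)`. Hence `div Y =
div^H Y - g_c(H^⊥, Y)` (`IsOrthogonalExtension.riemannianDivergence_eq`).

Integrating `div(f u ∇^H e)` to zero then gives Green's formula with an error term, `∫ (Δ^H e) f dμ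
+ ∫ g_c(∇^H e, ∇^H f) dμ = -∫ f u g_c(∇^H ln u - H^⊥, ∇^H e) dvol`
(`IsOrthogonalExtension.integral_horizontalLaplacian_mul_add`). One direction of the equivalence is
immediate. For the other, varying `f` kills the continuous factor `u g_c(∇^H ln u - H^⊥, ∇^H e)`,
and varying `e` kills the vector, since differentials of test functions separate tangent vectors.

The divergence theorem (`integral_mul_riemannianDivergence_add`) rests on `√G div Y = ∑ ∂_c(√G Y^c)`
in a chart, on the identification of the glued measure with the chart measure, and on a partition of
unity. The orthonormal bases are chosen point by point with no continuity, so every regularity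
statement about a trace is obtained by rewriting it in a smooth local frame with the inverse Gram
matrix. -/

noncomputable section

namespace SubRiem

/-! ### Gram matrices and traces with respect to an inner product. -/

section LinearAlgebra

/-- The Gram matrix of a family of vectors. -/
def gram {V ι : Type*} [AddCommGroup V] [Module ℝ V] (B : LinearMap.BilinForm ℝ V) (v : ι → V) :
    Matrix ι ι ℝ :=
  Matrix.of fun i j => B (v i) (v j)

variable {V : Type*} [AddCommGroup V] [Module ℝ V]

theorem orthonormalBasis_apply [FiniteDimensional ℝ V] {B : LinearMap.BilinForm ℝ V}
    (hB : IsInner B) (i j : Fin (Module.finrank ℝ V)) :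
    B (orthonormalBasis hB i) (orthonormalBasis hB j) = if i = j then 1 else 0 :=
  hB.exists_orthonormal_basis.choose_spec i j

theorem repr_eq_of_orthonormal {ι : Type*} [Fintype ι] [DecidableEq ι]
    {B : LinearMap.BilinForm ℝ V} (b : Module.Basis ι ℝ V)
    (hb : ∀ i j, B (b i) (b j) = if i = j then 1 else 0) (w : V) (i : ι) :
    b.repr w i = B w (b i) := by
  conv_rhs => rw [← b.sum_repr w]
  simp only [map_sum, LinearMap.sum_apply, map_smul, LinearMap.smul_apply, hb]
  simp

variable {ι κ : Type*} [Fintype ι] [DecidableEq ι] [Fintype κ] [DecidableEq κ]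

/-- With `C` the matrix of `v` in the orthonormal basis `b`, the Gram matrix is `Cᵀ C` and
`v.toMatrix b` is inverse to `C`. The two index types may differ: chosen bases are indexed by `Fin
(finrank ..)`, local frames by `Fin k`. -/
theorem gram_mul_eq_one {B : LinearMap.BilinForm ℝ V}
    (b : Module.Basis ι ℝ V) (hb : ∀ i j, B (b i) (b j) = if i = j then 1 else 0)
    (v : Module.Basis κ ℝ V) :
    gram B v * (v.toMatrix b * (v.toMatrix b).transpose) = 1 := by
  have hG : gram B v = (b.toMatrix v).transpose * b.toMatrix v := by
    ext j k
    simp only [gram, Matrix.of_apply, Matrix.mul_apply, Matrix.transpose_apply,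
      Module.Basis.toMatrix_apply]
    conv_lhs => rw [← b.sum_repr (v j)]
    simp only [map_sum, LinearMap.sum_apply, map_smul, LinearMap.smul_apply, smul_eq_mul]
    refine Finset.sum_congr rfl fun i _ => ?_
    conv_lhs => rw [← b.sum_repr (v k)]
    simp only [map_sum, map_smul, hb, smul_eq_mul]
    simp
  rw [hG, Matrix.mul_assoc, ← Matrix.mul_assoc (b.toMatrix v),
    Module.Basis.toMatrix_mul_toMatrix_flip, Matrix.one_mul, ← Matrix.transpose_mul,
    Module.Basis.toMatrix_mul_toMatrix_flip, Matrix.transpose_one]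

theorem gram_inv_eq {B : LinearMap.BilinForm ℝ V}
    (b : Module.Basis ι ℝ V) (hb : ∀ i j, B (b i) (b j) = if i = j then 1 else 0)
    (v : Module.Basis κ ℝ V) :
    (gram B v)⁻¹ = v.toMatrix b * (v.toMatrix b).transpose :=
  Matrix.inv_eq_right_inv (gram_mul_eq_one b hb v)

theorem gram_det_ne_zero [FiniteDimensional ℝ V] {B : LinearMap.BilinForm ℝ V} (hB : IsInner B)
    (v : Module.Basis κ ℝ V) : (gram B v).det ≠ 0 := by
  have h := gram_mul_eq_one (orthonormalBasis hB) (orthonormalBasis_apply hB) v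
  exact (Matrix.isUnit_det_of_right_inverse h).ne_zero

/-- The inverse Gram matrix has the form `A Aᵀ`, hence a nonnegative determinant, and the product of
the two determinants is 1. -/
theorem gram_det_pos [FiniteDimensional ℝ V] {B : LinearMap.BilinForm ℝ V} (hB : IsInner B)
    (v : Module.Basis κ ℝ V) : 0 < (gram B v).det := by
  have h := congrArg Matrix.det
    (gram_mul_eq_one (orthonormalBasis hB) (orthonormalBasis_apply hB) v)
  have hp : 0 ≤ (v.toMatrix (orthonormalBasis hB) *
      (v.toMatrix (orthonormalBasis hB)).transpose).det := by
    have := Matrix.posSemidef_self_mul_conjTranspose (v.toMatrix (orthonormalBasis hB))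
    rw [Matrix.conjTranspose_eq_transpose_of_trivial] at this
    exact this.det_nonneg
  rw [Matrix.det_mul, Matrix.det_one] at h
  exact lt_of_le_of_ne (by by_contra! hn; nlinarith) (gram_det_ne_zero hB v).symm

/-- The trace of a bilinear form with respect to an inner product, computed in any basis. -/
theorem sum_apply_self_eq_sum_gram_inv {B : LinearMap.BilinForm ℝ V}
    (b : Module.Basis ι ℝ V) (hb : ∀ i j, B (b i) (b j) = if i = j then 1 else 0)
    (v : Module.Basis κ ℝ V) (A : LinearMap.BilinForm ℝ V) :
    ∑ i, A (b i) (b i) = ∑ j, ∑ k, (gram B v)⁻¹ j k * A (v j) (v k) := by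
  rw [gram_inv_eq b hb v]
  have hbi : ∀ i, A (b i) (b i) =
      ∑ j, ∑ k, v.toMatrix b j i * v.toMatrix b k i * A (v j) (v k) := by
    intro i
    conv_lhs => rw [← v.sum_toMatrix_smul_self b i]
    simp only [map_sum, LinearMap.sum_apply, map_smul, LinearMap.smul_apply, smul_eq_mul,
      Finset.mul_sum]
    rw [Finset.sum_comm]
    exact Finset.sum_congr rfl fun j _ => Finset.sum_congr rfl fun k _ => by ring
  simp only [hbi, Matrix.mul_apply, Matrix.transpose_apply, Finset.sum_mul]
  rw [Finset.sum_comm]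
  exact Finset.sum_congr rfl fun j _ => Finset.sum_comm

theorem sum_apply_self_eq_of_orthonormal {B : LinearMap.BilinForm ℝ V}
    (b : Module.Basis ι ℝ V) (hb : ∀ i j, B (b i) (b j) = if i = j then 1 else 0)
    (v : Module.Basis κ ℝ V) (hv : ∀ i j, B (v i) (v j) = if i = j then 1 else 0)
    (A : LinearMap.BilinForm ℝ V) :
    ∑ i, A (b i) (b i) = ∑ j, A (v j) (v j) := by
  have hG : gram B v = 1 := by
    ext i j
    simp [gram, hv, Matrix.one_apply]
  rw [sum_apply_self_eq_sum_gram_inv b hb v, hG]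
  simp [Matrix.one_apply]

/-- A vector is recovered from its pairings with a basis through the inverse Gram matrix. -/
theorem eq_sum_gram_inv_smul [FiniteDimensional ℝ V] {B : LinearMap.BilinForm ℝ V}
    (hB : IsInner B) (v : Module.Basis κ ℝ V) (w : V) :
    w = ∑ j, (∑ k, (gram B v)⁻¹ j k * B w (v k)) • v j := by
  have hu : IsUnit (gram B v).det := (gram_det_ne_zero hB v).isUnit
  conv_lhs => rw [← v.sum_repr w]
  refine Finset.sum_congr rfl fun j _ => ?_
  congr 1
  have h1 : ∀ k, B w (v k) = ((gram B v).mulVec (v.repr w)) k := by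
    intro k
    conv_lhs => rw [← v.sum_repr w]
    simp only [gram, Matrix.mulVec, dotProduct, Matrix.of_apply, map_sum, LinearMap.sum_apply,
      map_smul, LinearMap.smul_apply, smul_eq_mul]
    exact Finset.sum_congr rfl fun i _ => by rw [hB.symm (v i) (v k), mul_comm]
  simp only [h1]
  change _ = ((gram B v)⁻¹.mulVec ((gram B v).mulVec (v.repr w))) j
  rw [Matrix.mulVec_mulVec, Matrix.nonsing_inv_mul _ hu, Matrix.one_mulVec]

end LinearAlgebra

/-! ### Derivative of a determinant. -/

section Determinant

variable {n : Type*} [Fintype n] [DecidableEq n]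

/-- Jacobi's formula for the derivative of a determinant. -/
theorem hasFDerivAt_det {F : Type*} [NormedAddCommGroup F] [NormedSpace ℝ F]
    {A : F → Matrix n n ℝ} {A' : n → n → F →L[ℝ] ℝ} {y : F}
    (hA : ∀ i j, HasFDerivAt (fun z => A z i j) (A' i j) y) :
    HasFDerivAt (fun z => (A z).det) (∑ i, ∑ j, (A y).adjugate j i • A' i j) y := by
  simp only [Matrix.det_apply]
  have h : HasFDerivAt (fun z => ∑ σ : Equiv.Perm n, Equiv.Perm.sign σ • ∏ i, A z (σ i) i)
      (∑ σ : Equiv.Perm n, Equiv.Perm.sign σ •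
        ∑ i, (∏ j ∈ Finset.univ.erase i, A y (σ j) j) • A' (σ i) i) y := by
    refine HasFDerivAt.fun_sum fun σ _ => ?_
    exact (HasFDerivAt.finsetProd fun i _ => hA (σ i) i).const_smul (Equiv.Perm.sign σ)
  convert h using 1
  ext v
  -- Cramer's rule: pairing with row `j` of the adjugate is the determinant with column `j` replaced
  -- by its derivative. Its permutation expansion gives the product rule terms that differentiate
  -- the factor of column `j`.
  have hcol : ∀ j, ∑ i, (A y).adjugate j i * A' i j v =
      ((A y).updateCol j fun i => A' i j v).det := by
    intro j
    rw [← Matrix.cramer_apply, Matrix.cramer_eq_adjugate_mulVec]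
    rfl
  simp only [sum_apply, smul_apply, smul_eq_mul]
  rw [Finset.sum_comm]
  simp only [hcol, Matrix.det_apply]
  rw [Finset.sum_comm]
  refine Finset.sum_congr rfl fun σ _ => ?_
  rw [← Finset.smul_sum]
  congr 1
  refine Finset.sum_congr rfl fun j _ => ?_
  rw [← Finset.prod_erase_mul _ _ (Finset.mem_univ j), Matrix.updateCol_self]
  congr 1
  exact Finset.prod_congr rfl fun i hi => by
    rw [Matrix.updateCol_ne (Finset.ne_of_mem_erase hi)]

end Determinant

/-! ### Smoothness of determinants and inverse matrices. -/

section MatrixSmooth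

variable {n : Type*} [Fintype n] [DecidableEq n]
  {E H N : Type*} [NormedAddCommGroup E] [NormedSpace ℝ E] [TopologicalSpace H]
  {I : ModelWithCorners ℝ E H} [TopologicalSpace N] [ChartedSpace H N] {r : ℕ∞ω}

theorem contMDiffAt_det {A : N → Matrix n n ℝ} {x : N}
    (hA : ∀ i j, ContMDiffAt I 𝓘(ℝ, ℝ) r (fun y => A y i j) x) :
    ContMDiffAt I 𝓘(ℝ, ℝ) r (fun y => (A y).det) x := by
  simp only [Matrix.det_apply']
  exact contMDiffAt_finsetSum fun σ _ =>
    contMDiffAt_const.mul (contMDiffAt_finsetProd fun i _ => hA (σ i) i)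

theorem contMDiffAt_matrix_inv {A : N → Matrix n n ℝ} {x : N}
    (hA : ∀ i j, ContMDiffAt I 𝓘(ℝ, ℝ) r (fun y => A y i j) x) (hx : (A x).det ≠ 0) (i j : n) :
    ContMDiffAt I 𝓘(ℝ, ℝ) r (fun y => (A y)⁻¹ i j) x := by
  simp only [Matrix.inv_def, Matrix.smul_apply, smul_eq_mul, Ring.inverse_eq_inv']
  refine ContMDiffAt.mul ?_ ?_
  · exact ContDiffAt.comp_contMDiffAt (f := fun y => (A y).det) (g := fun t : ℝ => t⁻¹)
      (contDiffAt_inv ℝ hx) (contMDiffAt_det hA)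
  -- An adjugate entry is the determinant of `A` with one row made constant, so the determinant
  -- lemma applies again.
  · simp only [Matrix.adjugate_apply]
    refine contMDiffAt_det fun a b => ?_
    by_cases h : a = j
    · subst h
      simpa using contMDiffAt_const
    · simpa [Matrix.updateRow_ne h] using hA a b

end MatrixSmooth

end SubRiem

end

noncomputable section

namespace SubRiem

variable {m : ℕ} {M : Type*} [TopologicalSpace M] [ChartedSpace (EuclideanSpace ℝ (Fin m)) M]
  [IsManifold (𝓡 m) ∞ M]

/-! ### Smooth and differentiable vector fields. -/

section Smoothness

/-- The vector field `X` is smooth at the point `x`. -/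
def SmoothFieldAt (X : ∀ x : M, TangentSpace (𝓡 m) x) (x : M) : Prop :=
  ContMDiffAt (𝓡 m) (𝓡 m).tangent ∞ (fun x => (⟨x, X x⟩ : TangentBundle (𝓡 m) M)) x

/-- The vector field `X` is differentiable at the point `x`. -/
def DiffFieldAt (X : ∀ x : M, TangentSpace (𝓡 m) x) (x : M) : Prop :=
  MDifferentiableAt (𝓡 m) (𝓡 m).tangent (fun x => (⟨x, X x⟩ : TangentBundle (𝓡 m) M)) x

theorem SmoothFieldAt.diffFieldAt {X : ∀ x : M, TangentSpace (𝓡 m) x} {x : M}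
    (hX : SmoothFieldAt X x) : DiffFieldAt X x :=
  ContMDiffAt.mdifferentiableAt hX (by simp)

theorem SmoothFieldOn.smoothFieldAt {X : ∀ x : M, TangentSpace (𝓡 m) x} {U : Set M} {x : M}
    (hX : SmoothFieldOn X U) (hU : IsOpen U) (hx : x ∈ U) : SmoothFieldAt X x :=
  ContMDiffOn.contMDiffAt hX (hU.mem_nhds hx)

theorem smoothFieldOn_of_forall_smoothFieldAt {X : ∀ x : M, TangentSpace (𝓡 m) x} {U : Set M}
    (hX : ∀ x ∈ U, SmoothFieldAt X x) : SmoothFieldOn X U :=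
  fun x hx => (hX x hx).contMDiffWithinAt

theorem SmoothFieldOn.mono {X : ∀ x : M, TangentSpace (𝓡 m) x} {U V : Set M}
    (hX : SmoothFieldOn X U) (hV : V ⊆ U) : SmoothFieldOn X V :=
  ContMDiffOn.mono hX hV

theorem smoothFieldAt_extendVector {x : M} (v : TangentSpace (𝓡 m) x) :
    SmoothFieldAt (extendVector v) x :=
  FiberBundle.contMDiffAt_extend (𝓡 m) (EuclideanSpace ℝ (Fin m)) v

theorem extendVector_self {x : M} (v : TangentSpace (𝓡 m) x) : extendVector v x = v :=
  FiberBundle.extend_apply_self _ v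

theorem smoothFieldAt_metricForm (g : RiemannianMetricOn m M)
    {X Y : ∀ x : M, TangentSpace (𝓡 m) x} {x : M}
    (hX : SmoothFieldAt X x) (hY : SmoothFieldAt Y x) :
    ContMDiffAt (𝓡 m) 𝓘(ℝ, ℝ) ∞ (fun y => metricForm g y (X y) (Y y)) x := by
  have : ContMDiffAt (𝓡 m) ((𝓡 m).prod 𝓘(ℝ)) ∞
      (fun y => Bundle.TotalSpace.mk' ℝ (E := Bundle.Trivial M ℝ) y (g.inner y (X y) (Y y))) x :=
    ContMDiffAt.clm_bundle_apply₂ (F₁ := EuclideanSpace ℝ (Fin m))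
      (F₂ := EuclideanSpace ℝ (Fin m)) g.contMDiff.contMDiffAt hX hY
  simp only [Bundle.contMDiffAt_totalSpace] at this
  exact this.2

/-- The first-order version is needed because `TensorialAt` quantifies over fields that are merely
differentiable at the point. -/
theorem DiffFieldAt.metricForm (g : RiemannianMetricOn m M)
    {X Y : ∀ x : M, TangentSpace (𝓡 m) x} {x : M}
    (hX : DiffFieldAt X x) (hY : DiffFieldAt Y x) :
    MDifferentiableAt (𝓡 m) 𝓘(ℝ, ℝ) (fun y => metricForm g y (X y) (Y y)) x := by
  have : MDifferentiableAt (𝓡 m) ((𝓡 m).prod 𝓘(ℝ))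
      (fun y => Bundle.TotalSpace.mk' ℝ (E := Bundle.Trivial M ℝ) y (g.inner y (X y) (Y y))) x :=
    MDifferentiableAt.clm_bundle_apply₂ (F₁ := EuclideanSpace ℝ (Fin m))
      (F₂ := EuclideanSpace ℝ (Fin m))
      (g.contMDiff.contMDiffAt.mdifferentiableAt (by simp)) hX hY
  simp only [mdifferentiableAt_totalSpace] at this
  exact this.2

/-- `X f` is the fibre component of the tangent map of `f` composed with the section `X`. -/
theorem SmoothFieldOn.contMDiffOn_mvfderiv {f : M → ℝ} {X : ∀ x : M, TangentSpace (𝓡 m) x}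
    {U : Set M} (hX : SmoothFieldOn X U) (hU : IsOpen U)
    (hf : ContMDiffOn (𝓡 m) 𝓘(ℝ, ℝ) ∞ f U) :
    ContMDiffOn (𝓡 m) 𝓘(ℝ, ℝ) ∞ (fun y => mvfderiv (𝓡 m) f y (X y)) U := by
  have h1 := (hf.contMDiffOn_tangentMapWithin (m := ∞) (by simp) hU.uniqueMDiffOn).comp hX
    (fun y hy => hy)
  have h2 := (contMDiff_snd_tangentBundle_modelSpace ℝ 𝓘(ℝ, ℝ) (n := ∞)).comp_contMDiffOn h1
  refine h2.congr fun y hy => ?_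
  change _ = (mfderivWithin (𝓡 m) 𝓘(ℝ, ℝ) f U y (X y) : ℝ)
  rw [mfderivWithin_of_isOpen hU hy]
  rfl

theorem mvfderiv_eq_zero_of_notMem_tsupport {h : M → ℝ} {x : M} (hx : x ∉ tsupport h) :
    mvfderiv (𝓡 m) h x = 0 := by
  have hev : h =ᶠ[𝓝 x] fun _ => (0 : ℝ) := notMem_tsupport_iff_eventuallyEq.1 hx
  have h1 : mfderiv (𝓡 m) 𝓘(ℝ, ℝ) h x = mfderiv (𝓡 m) 𝓘(ℝ, ℝ) (fun _ : M => (0 : ℝ)) x :=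
    hev.mfderiv_eq
  have h2 : mvfderiv (𝓡 m) h x = mvfderiv (𝓡 m) (fun _ : M => (0 : ℝ)) x := by
    ext v
    exact congrArg (fun L => L v) h1
  rw [h2, mvfderiv_const]

end Smoothness

/-! ### Smoothness of sections of a distribution, tested by pairings. -/

section Sections

variable {k : ℕ} (S : Distribution m M k) (g : RiemannianMetricOn m M)

/-- Generating vectors of a fiber, as a basis of the fiber. -/
def fiberBasis {x : M} {v : Fin k → TangentSpace (𝓡 m) x}
    (hv : Submodule.span ℝ (Set.range v) = S.fiber x) : Module.Basis (Fin k) ℝ (S.fiber x) :=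
  basisOfTopLeSpanOfCardEqFinrank
    (fun i => (⟨v i, hv ▸ Submodule.subset_span (Set.mem_range_self i)⟩ : S.fiber x))
    (by
      have h : Submodule.map (S.fiber x).subtype (Submodule.span ℝ (Set.range fun i =>
          (⟨v i, hv ▸ Submodule.subset_span (Set.mem_range_self i)⟩ : S.fiber x))) =
          Submodule.map (S.fiber x).subtype ⊤ := by
        rw [Submodule.map_span, ← Set.range_comp, Submodule.map_top, Submodule.range_subtype]
        exact hv
      exact (Submodule.map_injective_of_injective (S.fiber x).injective_subtype h).ge)
    (by rw [Fintype.card_fin, S.finrank_fiber])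

theorem fiberBasis_apply {x : M} {v : Fin k → TangentSpace (𝓡 m) x}
    (hv : Submodule.span ℝ (Set.range v) = S.fiber x) (i : Fin k) :
    (fiberBasis S hv i : TangentSpace (𝓡 m) x) = v i := by
  simp [fiberBasis]

/-- A section of a distribution is smooth if its pairings with local smooth sections are. -/
theorem smoothFieldAt_of_metricForm (W : ∀ y : M, S.fiber y) {x : M}
    (hW : ∀ (U : Set M) (X : ∀ y : M, TangentSpace (𝓡 m) y), IsOpen U → x ∈ U →
      SmoothFieldOn X U → (∀ y ∈ U, X y ∈ S.fiber y) →
      ContMDiffAt (𝓡 m) 𝓘(ℝ, ℝ) ∞ (fun y => metricForm g y (W y) (X y)) x) :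
    SmoothFieldAt (fun y => (W y : TangentSpace (𝓡 m) y)) x := by
  obtain ⟨U, hU, hx, X, hX, hspan⟩ := S.exists_frame x
  have hmem : ∀ i, ∀ y ∈ U, X i y ∈ S.fiber y := fun i y hy =>
    hspan y hy ▸ Submodule.subset_span (Set.mem_range_self i)
  let G : M → Matrix (Fin k) (Fin k) ℝ := fun y => gram (metricForm g y) fun i => X i y
  have hgram : ∀ y (hy : y ∈ U), G y =
      gram ((metricForm g y).restrict (S.fiber y)) (fiberBasis S (hspan y hy)) := by
    intro y hy
    ext i j
    simp [G, gram, fiberBasis_apply]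
  have hG : ∀ i j, ContMDiffAt (𝓡 m) 𝓘(ℝ, ℝ) ∞ (fun y => G y i j) x := fun i j =>
    smoothFieldAt_metricForm g ((hX i).smoothFieldAt hU hx) ((hX j).smoothFieldAt hU hx)
  have hdet : (G x).det ≠ 0 := by
    rw [hgram x hx]
    exact gram_det_ne_zero (metricForm_restrict_isInner g x _) _
  -- The components of `W` in the frame, recovered from its pairings by `eq_sum_gram_inv_smul`.
  let c : Fin k → M → ℝ := fun j y => ∑ l, (G y)⁻¹ j l * metricForm g y (W y) (X l y)
  have hc : ∀ j, ContMDiffAt (𝓡 m) 𝓘(ℝ, ℝ) ∞ (c j) x := fun j =>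
    contMDiffAt_finsetSum fun l _ =>
      (contMDiffAt_matrix_inv hG hdet j l).mul (hW U (X l) hU hx (hX l) (hmem l))
  have hsum : SmoothFieldAt (fun y => ∑ j, c j y • X j y) x :=
    ContMDiffAt.sum_section fun j _ => (hc j).smul_section ((hX j).smoothFieldAt hU hx)
  refine ContMDiffAt.congr_of_eventuallyEq hsum ?_
  filter_upwards [hU.mem_nhds hx] with y hy
  congr 1
  have h := congrArg (fun w : S.fiber y => (w : TangentSpace (𝓡 m) y))
    (eq_sum_gram_inv_smul (metricForm_restrict_isInner g y (S.fiber y))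
      (fiberBasis S (hspan y hy)) (W y))
  rw [← hgram y hy] at h
  simpa [fiberBasis_apply, c] using h

end Sections

/-! ### Projections, extensions and the horizontal gradient. -/

section Horizontal

variable {k l : ℕ} {S : SubRiemannianStructure m M k} {S' : Distribution m M l}
  (hS : IsSplitting S.toDistribution S') {g : RiemannianMetricOn m M}

theorem projH_add_projV (x : M) (v : TangentSpace (𝓡 m) x) :
    (projH hS x v : TangentSpace (𝓡 m) x) + projV hS x v = v :=
  Submodule.projection_add_projection_eq_self (hS x) v

theorem projH_apply_of_mem {x : M} {v : TangentSpace (𝓡 m) x} (hv : v ∈ S.fiber x) :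
    projH hS x v = ⟨v, hv⟩ :=
  Submodule.projectionOnto_apply_left (hS x) ⟨v, hv⟩

theorem projV_apply_of_mem {x : M} {v : TangentSpace (𝓡 m) x} (hv : v ∈ S'.fiber x) :
    projV hS x v = ⟨v, hv⟩ :=
  Submodule.projectionOnto_apply_left (hS x).symm ⟨v, hv⟩

theorem extendH_self {x : M} (v : S.fiber x) : extendH hS v x = v := by
  rw [extendH, extendVector_self, projH_apply_of_mem hS v.2]

theorem extendV_self {x : M} (t : S'.fiber x) : extendV hS t x = t := by
  rw [extendV, extendVector_self, projV_apply_of_mem hS t.2]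

theorem IsOrthogonalExtension.metricForm_projH (hg : IsOrthogonalExtension S S' g)
    (x : M) (v w : TangentSpace (𝓡 m) x)
    (hw : w ∈ S.fiber x) : metricForm g x (projH hS x v) w = metricForm g x v w := by
  conv_rhs => rw [← projH_add_projV hS x v]
  rw [map_add, LinearMap.add_apply, (metricForm_isInner g x).symm (projV hS x v),
    hg.orthogonal x w hw _ (projV hS x v).2, add_zero]

theorem IsOrthogonalExtension.gc_projH (hg : IsOrthogonalExtension S S' g)
    (x : M) (v : TangentSpace (𝓡 m) x) (w : S.fiber x) :
    S.gc x (projH hS x v) w = metricForm g x v w := by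
  rw [← hg.extends_gc, hg.metricForm_projH hS x v w w.2]

/-- Pairing with a horizontal field does not see the projection, as the discarded part is
orthogonal. So the pairings of the projected field are those of `V`. -/
theorem IsOrthogonalExtension.smoothFieldAt_projH (hg : IsOrthogonalExtension S S' g)
    {V : ∀ y : M, TangentSpace (𝓡 m) y} {x : M}
    (hV : SmoothFieldAt V x) :
    SmoothFieldAt (fun y => (projH hS y (V y) : TangentSpace (𝓡 m) y)) x := by
  refine smoothFieldAt_of_metricForm S.toDistribution g (fun y => projH hS y (V y)) ?_
  intro U X hU hx hX hmem
  refine (smoothFieldAt_metricForm g hV (hX.smoothFieldAt hU hx)).congr_of_eventuallyEq ?_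
  filter_upwards [hU.mem_nhds hx] with y hy
  exact hg.metricForm_projH hS y _ _ (hmem y hy)

theorem IsOrthogonalExtension.smoothFieldAt_projV (hg : IsOrthogonalExtension S S' g)
    {V : ∀ y : M, TangentSpace (𝓡 m) y} {x : M}
    (hV : SmoothFieldAt V x) :
    SmoothFieldAt (fun y => (projV hS y (V y) : TangentSpace (𝓡 m) y)) x := by
  have h : SmoothFieldAt (fun y => V y - (projH hS y (V y) : TangentSpace (𝓡 m) y)) x :=
    ContMDiffAt.sub_section hV (hg.smoothFieldAt_projH hS hV)
  convert h using 3 with y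
  exact eq_sub_of_add_eq' (projH_add_projV hS y (V y))

theorem IsOrthogonalExtension.smoothFieldAt_extendH (hg : IsOrthogonalExtension S S' g)
    {x : M} (v : S.fiber x) :
    SmoothFieldAt (fun y => (extendH hS v y : TangentSpace (𝓡 m) y)) x :=
  hg.smoothFieldAt_projH hS (smoothFieldAt_extendVector _)

theorem IsOrthogonalExtension.smoothFieldAt_extendV (hg : IsOrthogonalExtension S S' g)
    {x : M} (t : S'.fiber x) :
    SmoothFieldAt (fun y => (extendV hS t y : TangentSpace (𝓡 m) y)) x :=
  hg.smoothFieldAt_projV hS (smoothFieldAt_extendVector _)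

theorem gc_horizontalGradient (f : M → ℝ) (x : M) (v : S.fiber x) :
    S.gc x (horizontalGradient S f x) v = mvfderiv (𝓡 m) f x v := by
  have h := LinearMap.BilinForm.apply_toDual_symm_apply
    (hB := (S.isInner_gc x).nondegenerate)
    (f := (mvfderiv (𝓡 m) f x).toLinearMap ∘ₗ (S.fiber x).subtype) (v := v)
  exact h

/-- Its pairing with a smooth horizontal `X` is `X f`. -/
theorem IsOrthogonalExtension.smoothFieldAt_horizontalGradient (hg : IsOrthogonalExtension S S' g)
    {f : M → ℝ}
    (hf : ContMDiff (𝓡 m) 𝓘(ℝ, ℝ) ∞ f) (x : M) :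
    SmoothFieldAt (fun y => (horizontalGradient S f y : TangentSpace (𝓡 m) y)) x := by
  refine smoothFieldAt_of_metricForm S.toDistribution g (fun y => horizontalGradient S f y) ?_
  intro U X hU hx hX hmem
  refine ((hX.contMDiffOn_mvfderiv hU hf.contMDiffOn).contMDiffAt
    (hU.mem_nhds hx)).congr_of_eventuallyEq ?_
  filter_upwards [hU.mem_nhds hx] with y hy
  rw [← gc_horizontalGradient (S := S) f y ⟨X y, hmem y hy⟩]
  exact hg.extends_gc y _ ⟨X y, hmem y hy⟩

end Horizontal

end SubRiem

end

noncomputable section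

namespace SubRiem

variable {m : ℕ} {M : Type*} [TopologicalSpace M] [ChartedSpace (EuclideanSpace ℝ (Fin m)) M]
  [IsManifold (𝓡 m) ∞ M] (g : RiemannianMetricOn m M)

/-! ### The Lie derivative of the metric and the Koszul formula as tensors. -/

section Tensoriality

open VectorField

theorem mvfderiv_metricForm_smul_left {f : M → ℝ} {X Y : ∀ x : M, TangentSpace (𝓡 m) x} {x : M}
    (hf : MDifferentiableAt (𝓡 m) 𝓘(ℝ, ℝ) f x) (hX : DiffFieldAt X x) (hY : DiffFieldAt Y x)
    (v : TangentSpace (𝓡 m) x) :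
    mvfderiv (𝓡 m) (fun y => metricForm g y ((f • X) y) (Y y)) x v =
      f x * mvfderiv (𝓡 m) (fun y => metricForm g y (X y) (Y y)) x v +
        mvfderiv (𝓡 m) f x v * metricForm g x (X x) (Y x) := by
  have h : (fun y => metricForm g y ((f • X) y) (Y y)) =
      fun y => f y * metricForm g y (X y) (Y y) := by
    ext y
    simp
  rw [h, mvfderiv_fun_mul hf (hX.metricForm g hY)]
  simp [mul_comm]

theorem mvfderiv_metricForm_smul_right {f : M → ℝ} {X Y : ∀ x : M, TangentSpace (𝓡 m) x} {x : M}
    (hf : MDifferentiableAt (𝓡 m) 𝓘(ℝ, ℝ) f x) (hX : DiffFieldAt X x) (hY : DiffFieldAt Y x)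
    (v : TangentSpace (𝓡 m) x) :
    mvfderiv (𝓡 m) (fun y => metricForm g y (X y) ((f • Y) y)) x v =
      f x * mvfderiv (𝓡 m) (fun y => metricForm g y (X y) (Y y)) x v +
        mvfderiv (𝓡 m) f x v * metricForm g x (X x) (Y x) := by
  simp only [fun y => (metricForm_isInner g y).symm (X y)]
  exact mvfderiv_metricForm_smul_left g hf hY hX v

theorem mvfderiv_metricForm_add_left {X X' Y : ∀ x : M, TangentSpace (𝓡 m) x} {x : M}
    (hX : DiffFieldAt X x) (hX' : DiffFieldAt X' x) (hY : DiffFieldAt Y x)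
    (v : TangentSpace (𝓡 m) x) :
    mvfderiv (𝓡 m) (fun y => metricForm g y ((X + X') y) (Y y)) x v =
      mvfderiv (𝓡 m) (fun y => metricForm g y (X y) (Y y)) x v +
        mvfderiv (𝓡 m) (fun y => metricForm g y (X' y) (Y y)) x v := by
  have h : (fun y => metricForm g y ((X + X') y) (Y y)) =
      fun y => metricForm g y (X y) (Y y) + metricForm g y (X' y) (Y y) := by
    ext y
    simp
  rw [h, mvfderiv_fun_add (hX.metricForm g hY) (hX'.metricForm g hY)]
  rfl

theorem mvfderiv_metricForm_add_right {X Y Y' : ∀ x : M, TangentSpace (𝓡 m) x} {x : M}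
    (hX : DiffFieldAt X x) (hY : DiffFieldAt Y x) (hY' : DiffFieldAt Y' x)
    (v : TangentSpace (𝓡 m) x) :
    mvfderiv (𝓡 m) (fun y => metricForm g y (X y) ((Y + Y') y)) x v =
      mvfderiv (𝓡 m) (fun y => metricForm g y (X y) (Y y)) x v +
        mvfderiv (𝓡 m) (fun y => metricForm g y (X y) (Y' y)) x v := by
  simp only [fun y => (metricForm_isInner g y).symm (X y)]
  exact mvfderiv_metricForm_add_left g hY hY' hX v

/-- The Lie derivative `(L_Y g)(X, Z)` of the metric. -/
def lieMetric (Y X Z : ∀ x : M, TangentSpace (𝓡 m) x) (x : M) : ℝ :=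
  mvfderiv (𝓡 m) (fun y => metricForm g y (X y) (Z y)) x (Y x)
    - metricForm g x (mlieBracket (𝓡 m) Y X x) (Z x)
    - metricForm g x (X x) (mlieBracket (𝓡 m) Y Z x)

theorem lieMetric_symm (Y X Z : ∀ x : M, TangentSpace (𝓡 m) x) (x : M) :
    lieMetric g Y X Z x = lieMetric g Y Z X x := by
  simp only [lieMetric, fun y => (metricForm_isInner g y).symm (X y),
    (metricForm_isInner g x).symm (mlieBracket (𝓡 m) Y X x)]
  ring

/-- For `f X`, the extra term `(Y f) g(X, Z)` of the product rule cancels against the one from `[Y,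
f X]`. -/
theorem tensorialAt_lieMetric_left (Y : ∀ x : M, TangentSpace (𝓡 m) x)
    {Z : ∀ x : M, TangentSpace (𝓡 m) x} {x : M} (hZ : DiffFieldAt Z x) :
    TensorialAt (𝓡 m) (EuclideanSpace ℝ (Fin m)) (fun X => lieMetric g Y X Z x) x where
  smul {f X} hf hX := by
    simp only [lieMetric]
    rw [mvfderiv_metricForm_smul_left g hf hX hZ, mlieBracket_smul_right hf hX]
    simp only [Pi.smul_apply', map_add, map_smul, LinearMap.add_apply, LinearMap.smul_apply,
      smul_eq_mul]
    ring
  add {X X'} hX hX' := by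
    simp only [lieMetric]
    rw [mvfderiv_metricForm_add_left g hX hX' hZ, mlieBracket_add_right hX hX']
    simp only [Pi.add_apply, map_add, LinearMap.add_apply]
    ring

theorem tensorialAt_lieMetric_right (Y : ∀ x : M, TangentSpace (𝓡 m) x)
    {X : ∀ x : M, TangentSpace (𝓡 m) x} {x : M} (hX : DiffFieldAt X x) :
    TensorialAt (𝓡 m) (EuclideanSpace ℝ (Fin m)) (fun Z => lieMetric g Y X Z x) x := by
  simp only [fun Z => lieMetric_symm g Y X Z x]
  exact tensorialAt_lieMetric_left g Y hX

/-- The Lie derivative `L_Y g` at a point, as a bilinear form. -/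
def lieForm (Y : ∀ x : M, TangentSpace (𝓡 m) x) (x : M) :
    LinearMap.BilinForm ℝ (TangentSpace (𝓡 m) x) :=
  (TensorialAt.mkHom₂ (I := 𝓡 m) (F := EuclideanSpace ℝ (Fin m)) (F' := EuclideanSpace ℝ (Fin m))
    (fun X Z => lieMetric g Y X Z x) x
    (fun _ hZ => tensorialAt_lieMetric_left g Y hZ)
    (fun _ hX => tensorialAt_lieMetric_right g Y hX)).toLinearMap₁₂

theorem lieForm_apply (Y : ∀ x : M, TangentSpace (𝓡 m) x) {X Z : ∀ x : M, TangentSpace (𝓡 m) x}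
    {x : M} (hX : DiffFieldAt X x) (hZ : DiffFieldAt Z x) :
    lieForm g Y x (X x) (Z x) = lieMetric g Y X Z x :=
  TensorialAt.mkHom₂_apply (fun _ hZ => tensorialAt_lieMetric_left g Y hZ)
    (fun _ hX => tensorialAt_lieMetric_right g Y hX) hX hZ

/-- Half the trace of `L_Y g`, the Riemannian divergence of `Y`. -/
def riemannianDivergence (Y : ∀ x : M, TangentSpace (𝓡 m) x) (x : M) : ℝ :=
  (1 / 2) * ∑ i, lieForm g Y x (orthonormalBasis (metricForm_isInner g x) i)
    (orthonormalBasis (metricForm_isInner g x) i)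

/-- For `f X`, the terms in `Y f` and `Z f` coming from the derivatives cancel against those from
`[f X, Y]` and `[f X, Z]`. -/
theorem tensorialAt_koszul_left {Y Z : ∀ x : M, TangentSpace (𝓡 m) x} {x : M}
    (hY : DiffFieldAt Y x) (hZ : DiffFieldAt Z x) :
    TensorialAt (𝓡 m) (EuclideanSpace ℝ (Fin m)) (fun X => koszul g X Y Z x) x where
  smul {f X} hf hX := by
    simp only [koszul]
    rw [mvfderiv_metricForm_smul_left g hf hX hZ, mvfderiv_metricForm_smul_left g hf hX hY,
      mlieBracket_smul_left hf hX, mlieBracket_smul_left hf hX]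
    simp only [Pi.smul_apply', map_add, map_smul, LinearMap.add_apply, LinearMap.smul_apply,
      smul_eq_mul]
    ring
  add {X X'} hX hX' := by
    simp only [koszul]
    rw [mvfderiv_metricForm_add_left g hX hX' hZ, mvfderiv_metricForm_add_left g hX hX' hY,
      mlieBracket_add_left hX hX', mlieBracket_add_left hX hX']
    simp only [Pi.add_apply, map_add, LinearMap.add_apply]
    ring

theorem tensorialAt_koszul_right {X Y : ∀ x : M, TangentSpace (𝓡 m) x} {x : M}
    (hX : DiffFieldAt X x) (hY : DiffFieldAt Y x) :
    TensorialAt (𝓡 m) (EuclideanSpace ℝ (Fin m)) (fun Z => koszul g X Y Z x) x where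
  smul {f Z} hf hZ := by
    simp only [koszul]
    rw [mvfderiv_metricForm_smul_right g hf hX hZ, mvfderiv_metricForm_smul_right g hf hY hZ,
      mlieBracket_smul_right hf hZ, mlieBracket_smul_right hf hZ]
    simp only [Pi.smul_apply', map_add, map_smul, LinearMap.add_apply, LinearMap.smul_apply,
      smul_eq_mul, (metricForm_isInner g x).symm (Z x)]
    ring
  add {Z Z'} hZ hZ' := by
    simp only [koszul]
    rw [mvfderiv_metricForm_add_right g hX hZ hZ', mvfderiv_metricForm_add_right g hY hZ hZ',
      mlieBracket_add_right hZ hZ', mlieBracket_add_right hZ hZ']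
    simp only [Pi.add_apply, map_add, LinearMap.add_apply]
    ring

/-- The Levi-Civita connection satisfies the Koszul formula. -/
theorem metricForm_leviCivita {X Y Z : ∀ x : M, TangentSpace (𝓡 m) x} {x : M}
    (hX : DiffFieldAt X x) (hY : DiffFieldAt Y x) (hZ : DiffFieldAt Z x) :
    metricForm g x (leviCivita g Y x (X x)) (Z x) = koszul g X Y Z x := by
  have hv : DiffFieldAt (extendVector (X x)) x := (smoothFieldAt_extendVector (X x)).diffFieldAt
  have ht := tensorialAt_koszul_right g hv hY
  -- `TensorialAt.mkHom` evaluates on the same constant-coefficient extension that `leviCivita`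
  -- uses.
  have h1 : ∀ w : TangentSpace (𝓡 m) x, koszul g (extendVector (X x)) Y (extendVector w) x =
      TensorialAt.mkHom _ x ht w := fun w => rfl
  have h2 : koszul g X Y Z x = koszul g (extendVector (X x)) Y Z x :=
    (tensorialAt_koszul_left g hY hZ).pointwise hX hv (extendVector_self (X x)).symm
  rw [h2, ← TensorialAt.mkHom_apply ht hZ, leviCivita]
  simp only [h1, map_sum, LinearMap.sum_apply, map_smul, LinearMap.smul_apply]
  conv_rhs => rw [← (orthonormalBasis (metricForm_isInner g x)).sum_repr (Z x)]
  simp only [map_sum, map_smul, repr_eq_of_orthonormal _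
    (orthonormalBasis_apply (metricForm_isInner g x)), smul_eq_mul]
  exact Finset.sum_congr rfl fun i _ => by rw [(metricForm_isInner g x).symm (Z x), mul_comm]

end Tensoriality

end SubRiem

end

noncomputable section

namespace SubRiem

variable {m : ℕ} {M : Type*} [TopologicalSpace M] [ChartedSpace (EuclideanSpace ℝ (Fin m)) M]
  [IsManifold (𝓡 m) ∞ M] {k l : ℕ} {S : SubRiemannianStructure m M k} {S' : Distribution m M l}
  (hS : IsSplitting S.toDistribution S') {g : RiemannianMetricOn m M}

/-! ### Divergence, horizontal divergence and mean curvature at a point. -/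

section PointwiseIdentity

open VectorField

/-- With equal outer arguments the two `X`-derivatives cancel and `[X, X]` vanishes; the remaining
brackets are paired with the horizontal `X`, so their projection can be dropped. -/
theorem IsOrthogonalExtension.horizontalKoszul_self (hg : IsOrthogonalExtension S S' g)
    (X Y : ∀ x : M, S.fiber x) (x : M) :
    horizontalKoszul hS X Y X x = (1 / 2) *
      lieMetric g (fun y => (Y y : TangentSpace (𝓡 m) y)) (fun y => (X y : TangentSpace (𝓡 m) y))
        (fun y => (X y : TangentSpace (𝓡 m) y)) x := by
  have hself : horizontalBracket hS X X x = 0 := by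
    simp [horizontalBracket]
  have hswap : horizontalBracket hS X Y x = -horizontalBracket hS Y X x := by
    rw [horizontalBracket, mlieBracket_swap_apply, map_neg]
    rfl
  have hbr : S.gc x (horizontalBracket hS Y X x) (X x) = metricForm g x
      (mlieBracket (𝓡 m) (fun y => (Y y : TangentSpace (𝓡 m) y))
        (fun y => (X y : TangentSpace (𝓡 m) y)) x) (X x) :=
    hg.gc_projH hS x _ _
  rw [horizontalKoszul, hself, hswap]
  simp only [map_neg, LinearMap.neg_apply, map_zero, LinearMap.zero_apply, hbr, lieMetric,
    fun y => (S.isInner_gc y).symm (Y y), fun y => hg.extends_gc y (X y) (X y),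
    (metricForm_isInner g x).symm (X x : TangentSpace (𝓡 m) x) (mlieBracket _ _ _ x)]
  ring

/-- Each summand is a Koszul expression whose outer arguments are the same extended basis vector; by
tensoriality only the value of that extension at `x` matters. -/
theorem IsOrthogonalExtension.horizontalDivergence_eq (hg : IsOrthogonalExtension S S' g)
    (Y : ∀ x : M, S.fiber x) (x : M) :
    horizontalDivergence hS Y x = (1 / 2) *
      ∑ i, lieForm g (fun y => (Y y : TangentSpace (𝓡 m) y)) x
        (horizontalBasis S x i) (horizontalBasis S x i) := by
  rw [horizontalDivergence, Finset.mul_sum]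
  refine Finset.sum_congr rfl fun i _ => ?_
  have hX := (hg.smoothFieldAt_extendH hS (horizontalBasis S x i)).diffFieldAt
  have h := lieForm_apply g (fun y => (Y y : TangentSpace (𝓡 m) y)) hX hX
  rw [extendH_self] at h
  have hon := orthonormalBasis_apply (S.isInner_gc x)
  rw [h, ← hg.horizontalKoszul_self hS, horizontalConnection]
  simp [horizontalBasis, hon]

/-- Both `T`-derivatives of `g(T, Y)` vanish, which is why orthogonality is assumed at every point;
`Y g(T, T)` and the two brackets remain. -/
theorem koszul_self_of_orthogonal {T Y : ∀ x : M, TangentSpace (𝓡 m) x} {x : M}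
    (hTY : ∀ y, metricForm g y (T y) (Y y) = 0) :
    koszul g T T Y x = -((1 / 2) * lieMetric g Y T T x) := by
  have hself : mlieBracket (𝓡 m) T T x = 0 := by simp
  rw [koszul, hself, mlieBracket_swap_apply]
  simp only [hTY, mvfderiv_const, lieMetric, map_neg, map_zero, LinearMap.neg_apply,
    LinearMap.zero_apply, zero_apply,
    (metricForm_isInner g x).symm (T x) (mlieBracket _ _ _ x)]
  ring

theorem IsOrthogonalExtension.gc_meanCurvature (hg : IsOrthogonalExtension S S' g)
    {Y : ∀ x : M, S.fiber x} {x : M}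
    (hY : DiffFieldAt (fun y => (Y y : TangentSpace (𝓡 m) y)) x) :
    S.gc x (meanCurvature hS g x) (Y x) = -((1 / 2) *
      ∑ β, lieForm g (fun y => (Y y : TangentSpace (𝓡 m) y)) x
        (orthonormalBasis (metricForm_restrict_isInner g x (S'.fiber x)) β)
        (orthonormalBasis (metricForm_restrict_isInner g x (S'.fiber x)) β)) := by
  rw [meanCurvature, map_sum, LinearMap.sum_apply, Finset.mul_sum, ← Finset.sum_neg_distrib]
  refine Finset.sum_congr rfl fun β _ => ?_
  set t := orthonormalBasis (metricForm_restrict_isInner g x (S'.fiber x)) β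
  have hT := (hg.smoothFieldAt_extendV hS t).diffFieldAt
  have h := lieForm_apply g (fun y => (Y y : TangentSpace (𝓡 m) y)) hT hT
  have hc := metricForm_leviCivita g hT hT hY
  rw [koszul_self_of_orthogonal] at hc
  · simp only [extendV_self] at h hc
    rw [h, ← hc, hg.gc_projH]
  · intro y
    rw [(metricForm_isInner g y).symm]
    exact hg.orthogonal y _ (Y y).2 _ (extendV hS t y).2

/-- The trace does not depend on the orthonormal basis, and orthonormal bases of the two orthogonal
summands together form one of the tangent space. -/
theorem IsOrthogonalExtension.sum_apply_self_eq_add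
    (hS : IsSplitting S.toDistribution S') (hg : IsOrthogonalExtension S S' g) (x : M)
    (A : LinearMap.BilinForm ℝ (TangentSpace (𝓡 m) x)) :
    ∑ i, A (orthonormalBasis (metricForm_isInner g x) i)
        (orthonormalBasis (metricForm_isInner g x) i) =
      ∑ i, A (horizontalBasis S x i) (horizontalBasis S x i) +
        ∑ β, A (orthonormalBasis (metricForm_restrict_isInner g x (S'.fiber x)) β)
          (orthonormalBasis (metricForm_restrict_isInner g x (S'.fiber x)) β) := by
  let b := ((horizontalBasis S x).prod
    (orthonormalBasis (metricForm_restrict_isInner g x (S'.fiber x)))).map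
      (Submodule.prodEquivOfIsCompl _ _ (hS x))
  have hbl : ∀ i, b (Sum.inl i) = (horizontalBasis S x i : TangentSpace (𝓡 m) x) := by
    intro i
    simp [b]
  have hbr : ∀ i, b (Sum.inr i) =
      (orthonormalBasis (metricForm_restrict_isInner g x (S'.fiber x)) i :
        TangentSpace (𝓡 m) x) := by
    intro i
    simp [b]
  rw [sum_apply_self_eq_of_orthonormal (orthonormalBasis (metricForm_isInner g x))
    (orthonormalBasis_apply _) b _ A, Fintype.sum_sum_type]
  · simp only [hbl, hbr]
  · rintro (i | i) (j | j)
    · rw [hbl, hbl, hg.extends_gc, horizontalBasis, orthonormalBasis_apply]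
      simp
    · rw [hbl, hbr, hg.orthogonal x _ (Subtype.prop _) _ (Subtype.prop _)]
      simp
    · rw [hbl, hbr, (metricForm_isInner g x).symm,
        hg.orthogonal x _ (Subtype.prop _) _ (Subtype.prop _)]
      simp
    · rw [hbr, hbr]
      have := orthonormalBasis_apply (metricForm_restrict_isInner g x (S'.fiber x)) i j
      simpa using this

/-- The divergence of a horizontal field is its horizontal divergence, corrected by the mean
curvature of the complement. -/
theorem IsOrthogonalExtension.riemannianDivergence_eq (hg : IsOrthogonalExtension S S' g)
    {Y : ∀ x : M, S.fiber x} {x : M}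
    (hY : DiffFieldAt (fun y => (Y y : TangentSpace (𝓡 m) y)) x) :
    riemannianDivergence g (fun y => (Y y : TangentSpace (𝓡 m) y)) x =
      horizontalDivergence hS Y x - S.gc x (meanCurvature hS g x) (Y x) := by
  rw [hg.gc_meanCurvature hS hY, hg.horizontalDivergence_eq hS, riemannianDivergence,
    hg.sum_apply_self_eq_add hS]
  ring

end PointwiseIdentity

end SubRiem

end

noncomputable section

namespace SubRiem

variable {m : ℕ} {M : Type*} [TopologicalSpace M] [ChartedSpace (EuclideanSpace ℝ (Fin m)) M]
  [IsManifold (𝓡 m) ∞ M] (g : RiemannianMetricOn m M)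

/-! ### Continuity of traces of the Lie derivative of the metric. -/

section Continuity

open VectorField

instance : IsManifold (𝓡 m) (minSmoothness ℝ 2) M := by
  rw [minSmoothness_of_isRCLikeNormedField]
  infer_instance

theorem SmoothFieldOn.contMDiffOn_lieMetric {X Y Z : ∀ x : M, TangentSpace (𝓡 m) x} {U : Set M}
    (hU : IsOpen U) (hY : SmoothFieldOn Y U) (hX : SmoothFieldOn X U) (hZ : SmoothFieldOn Z U) :
    ContMDiffOn (𝓡 m) 𝓘(ℝ, ℝ) ∞ (fun y => lieMetric g Y X Z y) U := by
  have hXZ : ContMDiffOn (𝓡 m) 𝓘(ℝ, ℝ) ∞ (fun y => metricForm g y (X y) (Z y)) U := fun y hy =>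
    (smoothFieldAt_metricForm g (hX.smoothFieldAt hU hy)
      (hZ.smoothFieldAt hU hy)).contMDiffWithinAt
  have hbr : ∀ {W : ∀ x : M, TangentSpace (𝓡 m) x}, SmoothFieldOn W U → ∀ y ∈ U,
      SmoothFieldAt (mlieBracket (𝓡 m) Y W) y := fun {W} hW y hy =>
    -- Since `∞ + 1` is `∞`, taking a bracket costs no regularity.
    haveI : IsManifold (𝓡 m) (((⊤ : ℕ∞) : ℕ∞ω) + 1) M := ‹IsManifold (𝓡 m) ∞ M›
    ContMDiffAt.mlieBracket_vectorField (m := ⊤) (n := ⊤)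
      (hY.smoothFieldAt hU hy) (hW.smoothFieldAt hU hy) (by simp)
  intro y hy
  have h1 := (hY.contMDiffOn_mvfderiv hU hXZ).contMDiffAt (hU.mem_nhds hy)
  have h2 := smoothFieldAt_metricForm g (hbr hX y hy) (hZ.smoothFieldAt hU hy)
  have h3 := smoothFieldAt_metricForm g (hX.smoothFieldAt hU hy) (hbr hZ y hy)
  exact ((h1.sub h2).sub h3).contMDiffWithinAt

/-- The trace of `L_Y g` along a distribution is continuous. -/
theorem continuous_sum_lieForm {k : ℕ} (D : Distribution m M k)
    {Y : ∀ x : M, TangentSpace (𝓡 m) x} (hY : SmoothFieldOn Y univ) {n : M → ℕ}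
    (b : ∀ y, Module.Basis (Fin (n y)) ℝ (D.fiber y))
    (hb : ∀ y i j, metricForm g y (b y i) (b y j) = if i = j then 1 else 0) :
    Continuous fun y => ∑ i, lieForm g Y y (b y i) (b y i) := by
  rw [continuous_iff_continuousAt]
  intro x
  obtain ⟨U, hU, hx, X, hX, hspan⟩ := D.exists_frame x
  let G : M → Matrix (Fin k) (Fin k) ℝ := fun y => gram (metricForm g y) fun i => X i y
  have hgram : ∀ y (hy : y ∈ U), G y =
      gram ((metricForm g y).restrict (D.fiber y)) (fiberBasis D (hspan y hy)) := by
    intro y hy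
    ext i j
    simp [G, gram, fiberBasis_apply]
  have hG : ∀ i j, ContMDiffAt (𝓡 m) 𝓘(ℝ, ℝ) ∞ (fun y => G y i j) x := fun i j =>
    smoothFieldAt_metricForm g ((hX i).smoothFieldAt hU hx) ((hX j).smoothFieldAt hU hx)
  have hdet : (G x).det ≠ 0 := by
    rw [hgram x hx]
    exact gram_det_ne_zero (metricForm_restrict_isInner g x _) _
  -- The bases `b y` need not vary continuously; this is the same trace written in the smooth frame.
  have hc : ContMDiffAt (𝓡 m) 𝓘(ℝ, ℝ) ∞
      (fun y => ∑ i, ∑ j, (G y)⁻¹ i j * lieMetric g Y (X i) (X j) y) x :=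
    contMDiffAt_finsetSum fun i _ => contMDiffAt_finsetSum fun j _ =>
      (contMDiffAt_matrix_inv hG hdet i j).mul
        (((hY.mono (subset_univ U)).contMDiffOn_lieMetric g hU (hX i) (hX j)).contMDiffAt
          (hU.mem_nhds hx))
  refine hc.continuousAt.congr ?_
  filter_upwards [hU.mem_nhds hx] with y hy
  have h := sum_apply_self_eq_sum_gram_inv (B := (metricForm g y).restrict (D.fiber y))
    (b y) (hb y) (fiberBasis D (hspan y hy)) ((lieForm g Y y).restrict (D.fiber y))
  rw [← hgram y hy] at h
  simp only [LinearMap.BilinForm.restrict_apply, LinearMap.domRestrict_apply,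
    fiberBasis_apply] at h
  rw [h]
  refine Finset.sum_congr rfl fun i _ => Finset.sum_congr rfl fun j _ => ?_
  rw [lieForm_apply g Y ((hX i).smoothFieldAt hU hy).diffFieldAt
    ((hX j).smoothFieldAt hU hy).diffFieldAt]

end Continuity

/-! ### Coordinate vector fields and their brackets. -/

section Coordinates

open VectorField

/-- The standard basis of the model space. -/
abbrev stdBasis (m : ℕ) : Module.Basis (Fin m) ℝ (EuclideanSpace ℝ (Fin m)) :=
  (EuclideanSpace.basisFun (Fin m) ℝ).toBasis

/-- The coordinate vector fields of the preferred chart at `x₀`. -/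
def coordField (x₀ : M) (a : Fin m) : ∀ x : M, TangentSpace (𝓡 m) x :=
  (trivializationAt (EuclideanSpace ℝ (Fin m)) (TangentSpace (𝓡 m)) x₀).localFrame (stdBasis m) a

/-- The components of a vector field in the preferred chart at `x₀`. -/
def coordCoeff (x₀ : M) (Y : ∀ x : M, TangentSpace (𝓡 m) x) (a : Fin m) (x : M) : ℝ :=
  (trivializationAt (EuclideanSpace ℝ (Fin m)) (TangentSpace (𝓡 m)) x₀).localFrameCoeff (𝓡 m)
    (stdBasis m) a x (Y x)

variable {x₀ : M}

theorem smoothFieldOn_coordField (a : Fin m) :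
    SmoothFieldOn (coordField x₀ a) (chartAt (EuclideanSpace ℝ (Fin m)) x₀).source :=
  Bundle.Trivialization.contMDiffOn_localFrame_baseSet ∞ _ (stdBasis m) a

theorem coordField_eq_symmL {x : M} (hx : x ∈ (chartAt (EuclideanSpace ℝ (Fin m)) x₀).source)
    (a : Fin m) : coordField x₀ a x =
      (trivializationAt (EuclideanSpace ℝ (Fin m)) (TangentSpace (𝓡 m)) x₀).symmL ℝ x
        (EuclideanSpace.single a 1) := by
  rw [coordField, Bundle.Trivialization.localFrame_apply_of_mem_baseSet (hx := hx)]
  simp only [Bundle.Trivialization.basisAt, Module.Basis.map_apply, OrthonormalBasis.coe_toBasis,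
    EuclideanSpace.basisFun_apply]
  exact ((trivializationAt (EuclideanSpace ℝ (Fin m)) (TangentSpace (𝓡 m)) x₀).symmL_apply
    hx _).symm

/-- Links the vectors `∂ᵢ` in `gramDet` to the local frame of the tangent bundle. -/
theorem mfderiv_chartAt_symm_single {y : EuclideanSpace ℝ (Fin m)}
    (hy : y ∈ (chartAt (EuclideanSpace ℝ (Fin m)) x₀).target) (a : Fin m) :
    mfderiv (𝓡 m) (𝓡 m) (chartAt (EuclideanSpace ℝ (Fin m)) x₀).symm y
      (EuclideanSpace.single a 1) =
      coordField x₀ a ((chartAt (EuclideanSpace ℝ (Fin m)) x₀).symm y) := by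
  have hx := (chartAt (EuclideanSpace ℝ (Fin m)) x₀).map_target hy
  rw [coordField_eq_symmL hx, TangentBundle.symmL_trivializationAt hx]
  simp only [mfld_simps, mfderivWithin_univ]
  -- The trivialization gives the derivative at `φ (φ.symm y)`. Its type depends on the base point,
  -- so the equality with `y` is used by substituting a variable, with both values read in the model
  -- space.
  have h : ∀ z, z = y → (mfderiv (𝓡 m) (𝓡 m) (chartAt (EuclideanSpace ℝ (Fin m)) x₀).symm y
      (EuclideanSpace.single a 1) : EuclideanSpace ℝ (Fin m)) =
      mfderiv (𝓡 m) (𝓡 m) (chartAt (EuclideanSpace ℝ (Fin m)) x₀).symm z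
        (EuclideanSpace.single a 1) := by
    rintro _ rfl
    rfl
  exact h _ ((chartAt (EuclideanSpace ℝ (Fin m)) x₀).right_inv hy)

theorem eq_sum_coordCoeff (Y : ∀ x : M, TangentSpace (𝓡 m) x) {x : M}
    (hx : x ∈ (chartAt (EuclideanSpace ℝ (Fin m)) x₀).source) :
    Y x = ∑ a, coordCoeff x₀ Y a x • coordField x₀ a x :=
  Bundle.Trivialization.eq_sum_localFrameCoeff_smul (s := Y) hx

theorem SmoothFieldOn.contMDiffOn_coordCoeff {Y : ∀ x : M, TangentSpace (𝓡 m) x}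
    (hY : SmoothFieldOn Y univ) (a : Fin m) :
    ContMDiffOn (𝓡 m) 𝓘(ℝ, ℝ) ∞ (coordCoeff x₀ Y a)
      (chartAt (EuclideanSpace ℝ (Fin m)) x₀).source := fun x hx =>
  (contMDiffAt_localFrameCoeff (e := trivializationAt (EuclideanSpace ℝ (Fin m))
    (TangentSpace (𝓡 m)) x₀) (stdBasis m) hx
    (hY.smoothFieldAt isOpen_univ (mem_univ x)) a).contMDiffWithinAt

/-- A constant vector field on the model space. -/
def constField (v : EuclideanSpace ℝ (Fin m)) :
    ∀ z : EuclideanSpace ℝ (Fin m), TangentSpace (𝓡 m) z :=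
  fun _ => v

theorem mpullback_extChartAt_constField {x : M}
    (hx : x ∈ (chartAt (EuclideanSpace ℝ (Fin m)) x₀).source) (a : Fin m) :
    mpullback (𝓡 m) (𝓡 m) (extChartAt (𝓡 m) x₀)
      (constField (EuclideanSpace.single a 1)) x = coordField x₀ a x := by
  have hb : x ∈ (trivializationAt (EuclideanSpace ℝ (Fin m)) (TangentSpace (𝓡 m)) x₀).baseSet := hx
  have hinv : (mfderiv (𝓡 m) (𝓡 m) (extChartAt (𝓡 m) x₀) x).inverse =
      (trivializationAt (EuclideanSpace ℝ (Fin m)) (TangentSpace (𝓡 m)) x₀).symmL ℝ x := by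
    refine ContinuousLinearMap.inverse_eq ?_ ?_
    · rw [← TangentBundle.continuousLinearMapAt_trivializationAt hx]
      ext1 v
      exact Bundle.Trivialization.continuousLinearMapAt_symmL _ hb v
    · rw [← TangentBundle.continuousLinearMapAt_trivializationAt hx]
      ext1 v
      exact Bundle.Trivialization.symmL_continuousLinearMapAt _ hb v
  rw [mpullback_apply, coordField_eq_symmL hx, hinv]
  rfl

/-- Coordinate fields are pullbacks of constant fields, pullback respects brackets, and constant
fields commute. -/
theorem mlieBracket_coordField {x : M}
    (hx : x ∈ (chartAt (EuclideanSpace ℝ (Fin m)) x₀).source) (a b : Fin m) :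
    mlieBracket (𝓡 m) (coordField x₀ a) (coordField x₀ b) x = 0 := by
  have hev : ∀ c : Fin m, coordField x₀ c =ᶠ[𝓝 x]
      mpullback (𝓡 m) (𝓡 m) (extChartAt (𝓡 m) x₀)
        (constField (EuclideanSpace.single c 1)) := fun c => by
    filter_upwards [(chartAt (EuclideanSpace ℝ (Fin m)) x₀).open_source.mem_nhds hx] with z hz
    exact (mpullback_extChartAt_constField hz c).symm
  have hconst : ∀ c : Fin m, DiffFieldAt
      (constField (EuclideanSpace.single c 1 : EuclideanSpace ℝ (Fin m)))
      (extChartAt (𝓡 m) x₀ x) := fun c =>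
    (contMDiffAt_vectorSpace_iff_contDiffAt (n := 1).2 contDiffAt_const).mdifferentiableAt (by simp)
  rw [(hev a).mlieBracket_vectorField_eq (hev b), ← mpullback_mlieBracket (n := 2) (hconst a)
    (hconst b) (contMDiffAt_extChartAt' hx) (by simp)]
  have h0 : mlieBracket (𝓡 m)
      (constField (EuclideanSpace.single a 1 : EuclideanSpace ℝ (Fin m)))
      (constField (EuclideanSpace.single b 1)) (extChartAt (𝓡 m) x₀ x) = 0 := by
    rw [← mlieBracketWithin_univ, mlieBracketWithin_eq_lieBracketWithin]
    change lieBracketWithin ℝ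
      (fun _ : EuclideanSpace ℝ (Fin m) => (EuclideanSpace.single a 1 : EuclideanSpace ℝ (Fin m)))
      (fun _ => (EuclideanSpace.single b 1 : EuclideanSpace ℝ (Fin m))) univ
      (extChartAt (𝓡 m) x₀ x) = 0
    simp [lieBracketWithin]
  rw [mpullback_apply, h0, map_zero]

end Coordinates
end SubRiem

end

/-! ### The Riemannian divergence in coordinates. -/

noncomputable section

namespace SubRiem

/-- Each of the two sums contracts `G⁻¹` with `G` and leaves one trace of `D`. It is applied with `D
a c = ∂_a Y^c`. -/
theorem sum_inv_mul_eq_two_mul_trace {n : Type*} [Fintype n] [DecidableEq n] {G : Matrix n n ℝ}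
    (hG : IsUnit G.det) (hsymm : ∀ i j, G i j = G j i) (D : n → n → ℝ) :
    ∑ a, ∑ b, G⁻¹ a b * (∑ c, D a c * G c b + ∑ c, D b c * G a c) = 2 * ∑ a, D a a := by
  have h1 : ∀ a c, ∑ b, G⁻¹ a b * G c b = if a = c then 1 else 0 := fun a c => by
    have h := congrFun (congrFun (Matrix.nonsing_inv_mul G hG) a) c
    rw [Matrix.mul_apply, Matrix.one_apply] at h
    simpa only [fun b => hsymm c b] using h
  have h2 : ∀ b c, ∑ a, G⁻¹ a b * G a c = if c = b then 1 else 0 := fun b c => by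
    have h := congrFun (congrFun (Matrix.mul_nonsing_inv G hG) c) b
    rw [Matrix.mul_apply, Matrix.one_apply] at h
    rw [← h]
    exact Finset.sum_congr rfl fun a _ => by rw [hsymm a c, mul_comm]
  have e1 : ∑ a, ∑ b, G⁻¹ a b * ∑ c, D a c * G c b = ∑ a, D a a := by
    refine Finset.sum_congr rfl fun a _ => ?_
    calc ∑ b, G⁻¹ a b * ∑ c, D a c * G c b
        = ∑ c, D a c * ∑ b, G⁻¹ a b * G c b := by
          simp only [Finset.mul_sum]
          rw [Finset.sum_comm]
          exact Finset.sum_congr rfl fun c _ => Finset.sum_congr rfl fun b _ => by ring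
      _ = D a a := by simp [h1]
  have e2 : ∑ a, ∑ b, G⁻¹ a b * ∑ c, D b c * G a c = ∑ a, D a a := by
    rw [Finset.sum_comm]
    refine Finset.sum_congr rfl fun b _ => ?_
    calc ∑ a, G⁻¹ a b * ∑ c, D b c * G a c
        = ∑ c, D b c * ∑ a, G⁻¹ a b * G a c := by
          simp only [Finset.mul_sum]
          rw [Finset.sum_comm]
          exact Finset.sum_congr rfl fun c _ => Finset.sum_congr rfl fun a _ => by ring
      _ = D b b := by simp [h2]
  simp only [mul_add, Finset.sum_add_distrib]
  rw [e1, e2]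
  ring

variable {m : ℕ} {M : Type*} [TopologicalSpace M] [ChartedSpace (EuclideanSpace ℝ (Fin m)) M]
  [IsManifold (𝓡 m) ∞ M] (g : RiemannianMetricOn m M)

section CoordinateDivergence

open VectorField

theorem diffFieldAt_sum_smul {ι : Type*} (s : Finset ι) {f : ι → M → ℝ}
    {V : ι → ∀ x : M, TangentSpace (𝓡 m) x} {x : M}
    (hf : ∀ c, MDifferentiableAt (𝓡 m) 𝓘(ℝ, ℝ) (f c) x) (hV : ∀ c, DiffFieldAt (V c) x) :
    DiffFieldAt (fun y => ∑ c ∈ s, f c y • V c y) x :=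
  MDifferentiableAt.sum_section fun c _ => (hf c).smul_section (hV c)

theorem mlieBracket_sum_smul_left {ι : Type*} (s : Finset ι) {f : ι → M → ℝ}
    {V : ι → ∀ x : M, TangentSpace (𝓡 m) x} (W : ∀ x : M, TangentSpace (𝓡 m) x) {x : M}
    (hf : ∀ c, MDifferentiableAt (𝓡 m) 𝓘(ℝ, ℝ) (f c) x) (hV : ∀ c, DiffFieldAt (V c) x) :
    mlieBracket (𝓡 m) (fun y => ∑ c ∈ s, f c y • V c y) W x =
      ∑ c ∈ s, (-mvfderiv (𝓡 m) (f c) x (W x) • V c x +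
        f c x • mlieBracket (𝓡 m) (V c) W x) := by
  classical
  induction s using Finset.induction_on with
  | empty =>
    simp only [Finset.sum_empty]
    exact congrFun mlieBracket_zero_left x
  | insert c s hc ih =>
    have h : (fun y => ∑ d ∈ insert c s, f d y • V d y) =
        f c • V c + fun y => ∑ d ∈ s, f d y • V d y := by
      ext1 y
      simp [Finset.sum_insert hc]
    rw [h, mlieBracket_add_left ((hf c).smul_section (hV c)) (diffFieldAt_sum_smul s hf hV),
      mlieBracket_smul_left (hf c) (hV c), ih, Finset.sum_insert hc]

variable {x₀ : M}

theorem mlieBracket_coordField_right {Y : ∀ x : M, TangentSpace (𝓡 m) x}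
    (hY : SmoothFieldOn Y univ) {x : M}
    (hx : x ∈ (chartAt (EuclideanSpace ℝ (Fin m)) x₀).source) (a : Fin m) :
    mlieBracket (𝓡 m) Y (coordField x₀ a) x =
      -∑ c, mvfderiv (𝓡 m) (coordCoeff x₀ Y c) x (coordField x₀ a x) • coordField x₀ c x := by
  have hopen := (chartAt (EuclideanSpace ℝ (Fin m)) x₀).open_source
  have hev : Y =ᶠ[𝓝 x] fun y => ∑ c, coordCoeff x₀ Y c y • coordField x₀ c y := by
    filter_upwards [hopen.mem_nhds hx] with y hy
    exact eq_sum_coordCoeff Y hy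
  have h1 : mlieBracket (𝓡 m) Y (coordField x₀ a) x = mlieBracket (𝓡 m)
      (fun y => ∑ c, coordCoeff x₀ Y c y • coordField x₀ c y) (coordField x₀ a) x :=
    hev.mlieBracket_vectorField_eq EventuallyEq.rfl
  rw [h1, mlieBracket_sum_smul_left _ _
    (fun c => ((hY.contMDiffOn_coordCoeff c).contMDiffAt (hopen.mem_nhds hx)).mdifferentiableAt
      (by simp))
    (fun c => ((smoothFieldOn_coordField c).smoothFieldAt hopen hx).diffFieldAt)]
  simp [mlieBracket_coordField hx]

/-- The components of the metric in the preferred chart at `x₀`. -/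
def coordMetric (x₀ : M) (x : M) : Matrix (Fin m) (Fin m) ℝ :=
  gram (metricForm g x) fun a => coordField x₀ a x

theorem coordMetric_symm (x : M) (a b : Fin m) :
    coordMetric g x₀ x a b = coordMetric g x₀ x b a :=
  (metricForm_isInner g x).symm _ _

theorem lieMetric_coordField {Y : ∀ x : M, TangentSpace (𝓡 m) x}
    (hY : SmoothFieldOn Y univ) {x : M}
    (hx : x ∈ (chartAt (EuclideanSpace ℝ (Fin m)) x₀).source) (a b : Fin m) :
    lieMetric g Y (coordField x₀ a) (coordField x₀ b) x =
      mvfderiv (𝓡 m) (fun y => coordMetric g x₀ y a b) x (Y x) +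
      (∑ c, mvfderiv (𝓡 m) (coordCoeff x₀ Y c) x (coordField x₀ a x) * coordMetric g x₀ x c b +
        ∑ c, mvfderiv (𝓡 m) (coordCoeff x₀ Y c) x (coordField x₀ b x) *
          coordMetric g x₀ x a c) := by
  rw [lieMetric, mlieBracket_coordField_right hY hx, mlieBracket_coordField_right hY hx]
  simp only [map_neg, map_sum, map_smul, LinearMap.neg_apply, LinearMap.sum_apply,
    LinearMap.smul_apply, smul_eq_mul, coordMetric, gram, Matrix.of_apply]
  ring

/-- The coordinate fields at a point of the chart domain, as a basis. -/
def coordBasis {x : M} (hx : x ∈ (chartAt (EuclideanSpace ℝ (Fin m)) x₀).source) :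
    Module.Basis (Fin m) ℝ (TangentSpace (𝓡 m) x) :=
  (trivializationAt (EuclideanSpace ℝ (Fin m)) (TangentSpace (𝓡 m)) x₀).basisAt (stdBasis m) hx

theorem coordBasis_apply {x : M} (hx : x ∈ (chartAt (EuclideanSpace ℝ (Fin m)) x₀).source)
    (a : Fin m) : coordBasis hx a = coordField x₀ a x :=
  (Bundle.Trivialization.localFrame_apply_of_mem_baseSet (hx := hx) _ _).symm

theorem coordMetric_eq_gram {x : M}
    (hx : x ∈ (chartAt (EuclideanSpace ℝ (Fin m)) x₀).source) :
    coordMetric g x₀ x = gram (metricForm g x) (coordBasis hx) := by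
  ext a b
  simp [coordMetric, gram, coordBasis_apply]

theorem coordMetric_det_pos {x : M}
    (hx : x ∈ (chartAt (EuclideanSpace ℝ (Fin m)) x₀).source) :
    0 < (coordMetric g x₀ x).det := by
  rw [coordMetric_eq_gram g hx]
  exact gram_det_pos (metricForm_isInner g x) _

/-- The trace is taken in the coordinate basis: the terms with `∂_a Y^c` contribute twice `∑ ∂_c
Y^c`, which absorbs the factor one half. -/
theorem riemannianDivergence_eq_coord {Y : ∀ x : M, TangentSpace (𝓡 m) x}
    (hY : SmoothFieldOn Y univ) {x : M}
    (hx : x ∈ (chartAt (EuclideanSpace ℝ (Fin m)) x₀).source) :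
    riemannianDivergence g Y x =
      ∑ c, mvfderiv (𝓡 m) (coordCoeff x₀ Y c) x (coordField x₀ c x) +
      (1 / 2) * ∑ a, ∑ b, (coordMetric g x₀ x)⁻¹ a b *
        mvfderiv (𝓡 m) (fun y => coordMetric g x₀ y a b) x (Y x) := by
  have hopen := (chartAt (EuclideanSpace ℝ (Fin m)) x₀).open_source
  have hd : ∀ a, DiffFieldAt (coordField x₀ a) x := fun a =>
    ((smoothFieldOn_coordField a).smoothFieldAt hopen hx).diffFieldAt
  rw [riemannianDivergence, sum_apply_self_eq_sum_gram_inv _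
    (orthonormalBasis_apply (metricForm_isInner g x)) (coordBasis hx), ← coordMetric_eq_gram]
  simp only [coordBasis_apply, lieForm_apply g Y (hd _) (hd _), lieMetric_coordField g hY hx]
  have h := sum_inv_mul_eq_two_mul_trace (coordMetric_det_pos g hx).ne'.isUnit
    (coordMetric_symm g x)
    fun a c => mvfderiv (𝓡 m) (coordCoeff x₀ Y c) x (coordField x₀ a x)
  simp only [mul_add, Finset.sum_add_distrib] at h ⊢
  linarith

end CoordinateDivergence

end SubRiem

end

noncomputable section

namespace SubRiem

variable {m : ℕ} {M : Type*} [TopologicalSpace M] [ChartedSpace (EuclideanSpace ℝ (Fin m)) M]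
  [IsManifold (𝓡 m) ∞ M] (g : RiemannianMetricOn m M)

/-! ### Calculus with the Gram determinant in a chart. -/

section ChartCalculus

variable {x₀ : M}

theorem contDiffOn_comp_chartAt_symm {f : M → ℝ}
    (hf : ContMDiffOn (𝓡 m) 𝓘(ℝ, ℝ) ∞ f (chartAt (EuclideanSpace ℝ (Fin m)) x₀).source) :
    ContDiffOn ℝ ∞ (fun y => f ((chartAt (EuclideanSpace ℝ (Fin m)) x₀).symm y))
      (chartAt (EuclideanSpace ℝ (Fin m)) x₀).target :=
  contMDiffOn_iff_contDiffOn.1 (hf.comp (contMDiffOn_chart_symm (I := 𝓡 m) (n := ∞))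
    fun _ hy => (chartAt (EuclideanSpace ℝ (Fin m)) x₀).map_target hy)

theorem fderiv_comp_chartAt_symm {f : M → ℝ} {y : EuclideanSpace ℝ (Fin m)}
    (hy : y ∈ (chartAt (EuclideanSpace ℝ (Fin m)) x₀).target)
    (hf : MDifferentiableAt (𝓡 m) 𝓘(ℝ, ℝ) f
      ((chartAt (EuclideanSpace ℝ (Fin m)) x₀).symm y)) (a : Fin m) :
    fderiv ℝ (fun y => f ((chartAt (EuclideanSpace ℝ (Fin m)) x₀).symm y)) y
        (EuclideanSpace.single a 1) =
      mvfderiv (𝓡 m) f ((chartAt (EuclideanSpace ℝ (Fin m)) x₀).symm y)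
        (coordField x₀ a ((chartAt (EuclideanSpace ℝ (Fin m)) x₀).symm y)) := by
  have hφ : MDifferentiableAt (𝓡 m) (𝓡 m) (chartAt (EuclideanSpace ℝ (Fin m)) x₀).symm y :=
    mdifferentiableAt_atlas_symm (chart_mem_atlas _ x₀) hy
  rw [← mfderiv_chartAt_symm_single hy, ← mfderiv_eq_fderiv]
  have h := mfderiv_comp y hf hφ
  exact congrArg (fun L => L (EuclideanSpace.single a 1)) h

theorem gramDet_eq_det_coordMetric {y : EuclideanSpace ℝ (Fin m)}
    (hy : y ∈ (chartAt (EuclideanSpace ℝ (Fin m)) x₀).target) :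
    gramDet g (chartAt (EuclideanSpace ℝ (Fin m)) x₀) y =
      (coordMetric g x₀ ((chartAt (EuclideanSpace ℝ (Fin m)) x₀).symm y)).det := by
  rw [gramDet]
  congr 1
  ext a b
  simp only [Matrix.of_apply, mfderiv_chartAt_symm_single hy, coordMetric, gram]

theorem gramDet_chartAt_pos {y : EuclideanSpace ℝ (Fin m)}
    (hy : y ∈ (chartAt (EuclideanSpace ℝ (Fin m)) x₀).target) :
    0 < gramDet g (chartAt (EuclideanSpace ℝ (Fin m)) x₀) y := by
  rw [gramDet_eq_det_coordMetric g hy]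
  exact coordMetric_det_pos g ((chartAt (EuclideanSpace ℝ (Fin m)) x₀).map_target hy)

theorem contMDiffOn_coordMetric (a b : Fin m) :
    ContMDiffOn (𝓡 m) 𝓘(ℝ, ℝ) ∞ (fun x => coordMetric g x₀ x a b)
      (chartAt (EuclideanSpace ℝ (Fin m)) x₀).source := fun _ hx =>
  have hopen := (chartAt (EuclideanSpace ℝ (Fin m)) x₀).open_source
  (smoothFieldAt_metricForm g ((smoothFieldOn_coordField a).smoothFieldAt hopen hx)
    ((smoothFieldOn_coordField b).smoothFieldAt hopen hx)).contMDiffWithinAt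

theorem contDiffOn_gramDet :
    ContDiffOn ℝ ∞ (gramDet g (chartAt (EuclideanSpace ℝ (Fin m)) x₀))
      (chartAt (EuclideanSpace ℝ (Fin m)) x₀).target := by
  have h : ContMDiffOn (𝓡 m) 𝓘(ℝ, ℝ) ∞ (fun x => (coordMetric g x₀ x).det)
      (chartAt (EuclideanSpace ℝ (Fin m)) x₀).source := fun x hx =>
    (contMDiffAt_det fun a b => (contMDiffOn_coordMetric g a b).contMDiffAt
      ((chartAt (EuclideanSpace ℝ (Fin m)) x₀).open_source.mem_nhds hx)).contMDiffWithinAt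
  exact (contDiffOn_comp_chartAt_symm h).congr fun y hy => gramDet_eq_det_coordMetric g hy

theorem contDiffOn_sqrt_gramDet :
    ContDiffOn ℝ ∞ (fun y => √(gramDet g (chartAt (EuclideanSpace ℝ (Fin m)) x₀) y))
      (chartAt (EuclideanSpace ℝ (Fin m)) x₀).target :=
  (contDiffOn_gramDet g).sqrt fun _ hy => (gramDet_chartAt_pos g hy).ne'

/-- Jacobi's formula, with the adjugate written as determinant times inverse; symmetry of the metric
settles the order of the indices. -/
theorem fderiv_gramDet {y : EuclideanSpace ℝ (Fin m)}
    (hy : y ∈ (chartAt (EuclideanSpace ℝ (Fin m)) x₀).target) (c : Fin m) :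
    fderiv ℝ (gramDet g (chartAt (EuclideanSpace ℝ (Fin m)) x₀)) y (EuclideanSpace.single c 1) =
      gramDet g (chartAt (EuclideanSpace ℝ (Fin m)) x₀) y * ∑ a, ∑ b,
        (coordMetric g x₀ ((chartAt (EuclideanSpace ℝ (Fin m)) x₀).symm y))⁻¹ a b *
          mvfderiv (𝓡 m) (fun x => coordMetric g x₀ x a b)
            ((chartAt (EuclideanSpace ℝ (Fin m)) x₀).symm y)
            (coordField x₀ c ((chartAt (EuclideanSpace ℝ (Fin m)) x₀).symm y)) := by
  have hx := (chartAt (EuclideanSpace ℝ (Fin m)) x₀).map_target hy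
  have htn := (chartAt (EuclideanSpace ℝ (Fin m)) x₀).open_target.mem_nhds hy
  have hev : gramDet g (chartAt (EuclideanSpace ℝ (Fin m)) x₀) =ᶠ[𝓝 y] fun y =>
      (coordMetric g x₀ ((chartAt (EuclideanSpace ℝ (Fin m)) x₀).symm y)).det := by
    filter_upwards [htn] with z hz
    exact gramDet_eq_det_coordMetric g hz
  have hA : ∀ a b, HasFDerivAt
      (fun y => coordMetric g x₀ ((chartAt (EuclideanSpace ℝ (Fin m)) x₀).symm y) a b)
      (fderiv ℝ
        (fun y => coordMetric g x₀ ((chartAt (EuclideanSpace ℝ (Fin m)) x₀).symm y) a b) y) y :=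
    fun a b => (((contDiffOn_comp_chartAt_symm (contMDiffOn_coordMetric g a b)).contDiffAt
      htn).differentiableAt (by simp)).hasFDerivAt
  rw [hev.fderiv_eq, (hasFDerivAt_det hA).fderiv, gramDet_eq_det_coordMetric g hy]
  have hd := (coordMetric_det_pos g hx).ne'
  simp only [sum_apply, smul_apply, smul_eq_mul, Matrix.inv_def, Ring.inverse_eq_inv',
    Matrix.smul_apply, Finset.mul_sum]
  rw [Finset.sum_comm]
  refine Finset.sum_congr rfl fun a _ => Finset.sum_congr rfl fun b _ => ?_
  rw [fderiv_comp_chartAt_symm hy (((contMDiffOn_coordMetric g b a).contMDiffAt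
    ((chartAt (EuclideanSpace ℝ (Fin m)) x₀).open_source.mem_nhds hx)).mdifferentiableAt (by simp))]
  simp only [fun x => coordMetric_symm g (x₀ := x₀) x b a]
  field_simp

/-- The divergence in coordinates: `√G div Y = ∑ ∂_c (√G Y^c)`. -/
theorem sqrt_gramDet_mul_riemannianDivergence {Y : ∀ x : M, TangentSpace (𝓡 m) x}
    (hY : SmoothFieldOn Y univ) {y : EuclideanSpace ℝ (Fin m)}
    (hy : y ∈ (chartAt (EuclideanSpace ℝ (Fin m)) x₀).target) :
    √(gramDet g (chartAt (EuclideanSpace ℝ (Fin m)) x₀) y) *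
        riemannianDivergence g Y ((chartAt (EuclideanSpace ℝ (Fin m)) x₀).symm y) =
      ∑ c, fderiv ℝ (fun y => √(gramDet g (chartAt (EuclideanSpace ℝ (Fin m)) x₀) y) *
        coordCoeff x₀ Y c ((chartAt (EuclideanSpace ℝ (Fin m)) x₀).symm y)) y
          (EuclideanSpace.single c 1) := by
  have hx := (chartAt (EuclideanSpace ℝ (Fin m)) x₀).map_target hy
  have htn := (chartAt (EuclideanSpace ℝ (Fin m)) x₀).open_target.mem_nhds hy
  have hG := gramDet_chartAt_pos g hy
  have hGd : DifferentiableAt ℝ (gramDet g (chartAt (EuclideanSpace ℝ (Fin m)) x₀)) y :=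
    ((contDiffOn_gramDet g).contDiffAt htn).differentiableAt (by simp)
  have hsd : DifferentiableAt ℝ
      (fun y => √(gramDet g (chartAt (EuclideanSpace ℝ (Fin m)) x₀) y)) y :=
    ((contDiffOn_sqrt_gramDet g).contDiffAt htn).differentiableAt (by simp)
  have hYd : ∀ c, DifferentiableAt ℝ
      (fun y => coordCoeff x₀ Y c ((chartAt (EuclideanSpace ℝ (Fin m)) x₀).symm y)) y := fun c =>
    ((contDiffOn_comp_chartAt_symm (hY.contMDiffOn_coordCoeff c)).contDiffAt
      htn).differentiableAt (by simp)
  -- Product rule together with `∂_c √G = (1/2) √G tr(g⁻¹ ∂_c g)`.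
  have hterm : ∀ c, fderiv ℝ (fun y => √(gramDet g (chartAt (EuclideanSpace ℝ (Fin m)) x₀) y) *
        coordCoeff x₀ Y c ((chartAt (EuclideanSpace ℝ (Fin m)) x₀).symm y)) y
          (EuclideanSpace.single c 1) =
      √(gramDet g (chartAt (EuclideanSpace ℝ (Fin m)) x₀) y) *
        (mvfderiv (𝓡 m) (coordCoeff x₀ Y c) ((chartAt (EuclideanSpace ℝ (Fin m)) x₀).symm y)
            (coordField x₀ c ((chartAt (EuclideanSpace ℝ (Fin m)) x₀).symm y)) +
          (1 / 2) * (coordCoeff x₀ Y c ((chartAt (EuclideanSpace ℝ (Fin m)) x₀).symm y) *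
            ∑ a, ∑ b,
            (coordMetric g x₀ ((chartAt (EuclideanSpace ℝ (Fin m)) x₀).symm y))⁻¹ a b *
              mvfderiv (𝓡 m) (fun x => coordMetric g x₀ x a b)
                ((chartAt (EuclideanSpace ℝ (Fin m)) x₀).symm y)
                (coordField x₀ c ((chartAt (EuclideanSpace ℝ (Fin m)) x₀).symm y)))) := by
    intro c
    rw [fderiv_fun_mul hsd (hYd c), fderiv_sqrt hGd hG.ne']
    simp only [add_apply, smul_apply, smul_eq_mul]
    rw [fderiv_gramDet g hy, fderiv_comp_chartAt_symm hy
      (((hY.contMDiffOn_coordCoeff c).contMDiffAt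
        ((chartAt (EuclideanSpace ℝ (Fin m)) x₀).open_source.mem_nhds hx)).mdifferentiableAt
          (by simp))]
    set Q := ∑ a, ∑ b, (coordMetric g x₀ ((chartAt (EuclideanSpace ℝ (Fin m)) x₀).symm y))⁻¹ a b *
              mvfderiv (𝓡 m) (fun x => coordMetric g x₀ x a b)
                ((chartAt (EuclideanSpace ℝ (Fin m)) x₀).symm y)
                (coordField x₀ c ((chartAt (EuclideanSpace ℝ (Fin m)) x₀).symm y))
    have hs : √(gramDet g (chartAt (EuclideanSpace ℝ (Fin m)) x₀) y) ≠ 0 :=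
      (Real.sqrt_pos.2 hG).ne'
    have hss := Real.mul_self_sqrt hG.le
    set s := √(gramDet g (chartAt (EuclideanSpace ℝ (Fin m)) x₀) y)
    rw [← hss]
    field_simp
  simp only [hterm]
  rw [riemannianDivergence_eq_coord g hY hx, ← Finset.mul_sum, Finset.sum_add_distrib,
    ← Finset.mul_sum]
  congr 3
  -- It remains to expand the derivative of the metric along `Y` into coordinate derivatives.
  have hYx := eq_sum_coordCoeff (x₀ := x₀) Y hx
  conv_lhs =>
    enter [2, a, 2, b]
    rw [hYx]
  simp only [map_sum, map_smul, smul_eq_mul, Finset.mul_sum]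
  conv_rhs => rw [Finset.sum_comm]
  refine Finset.sum_congr rfl fun a _ => ?_
  conv_rhs => rw [Finset.sum_comm]
  exact Finset.sum_congr rfl fun b _ => Finset.sum_congr rfl fun c _ => by ring

end ChartCalculus
end SubRiem

end

noncomputable section

namespace SubRiem

variable {m : ℕ} {M : Type*} [TopologicalSpace M] [ChartedSpace (EuclideanSpace ℝ (Fin m)) M]
  [IsManifold (𝓡 m) ∞ M] (g : RiemannianMetricOn m M)

/-! ### Change of coordinates for the Gram determinant. -/

section ChangeOfCoordinates

/-- Both frames at `p` are images of the standard basis under coordinate changes to the chart at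
`p`; the cocycle relation compares them. -/
theorem coordField_eq_sum_tangentCoordChange {x x' p : M}
    (hx : p ∈ (chartAt (EuclideanSpace ℝ (Fin m)) x).source)
    (hx' : p ∈ (chartAt (EuclideanSpace ℝ (Fin m)) x').source) (a : Fin m) :
    coordField x a p =
      ∑ c, LinearMap.toMatrix (stdBasis m) (stdBasis m)
        (tangentCoordChange (𝓡 m) x x' p : EuclideanSpace ℝ (Fin m) →ₗ[ℝ] _) c a •
        coordField x' c p := by
  have hp : p ∈ (chartAt (EuclideanSpace ℝ (Fin m)) p).source := mem_chart_source _ p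
  have h1 : coordField x a p = tangentCoordChange (𝓡 m) x p p (EuclideanSpace.single a 1) := by
    rw [coordField_eq_symmL hx, TangentBundle.symmL_trivializationAt_eq_core hx]
    rfl
  have h2 : ∀ v : EuclideanSpace ℝ (Fin m), tangentCoordChange (𝓡 m) x' p p v =
      ∑ c, v c • coordField x' c p := by
    intro v
    have hsymm : tangentCoordChange (𝓡 m) x' p p v =
        (trivializationAt (EuclideanSpace ℝ (Fin m)) (TangentSpace (𝓡 m)) x').symmL ℝ p v := by
      rw [TangentBundle.symmL_trivializationAt_eq_core hx']
      rfl
    rw [hsymm]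
    simp only [coordField_eq_symmL hx', ← map_smul, ← map_sum]
    congr 1
    have := (stdBasis m).sum_repr v
    simpa using this.symm
  rw [h1, ← tangentCoordChange_comp (I := 𝓡 m) (w := x) (x := x') (y := p) (z := p)
    (by simp [hx, hx']), h2]
  refine Finset.sum_congr rfl fun c _ => ?_
  simp [LinearMap.toMatrix_apply]

theorem coordMetric_det_change {x x' p : M}
    (hx : p ∈ (chartAt (EuclideanSpace ℝ (Fin m)) x).source)
    (hx' : p ∈ (chartAt (EuclideanSpace ℝ (Fin m)) x').source) :
    (coordMetric g x p).det =
      (tangentCoordChange (𝓡 m) x x' p).det ^ 2 * (coordMetric g x' p).det := by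
  set T := LinearMap.toMatrix (stdBasis m) (stdBasis m)
    (tangentCoordChange (𝓡 m) x x' p : EuclideanSpace ℝ (Fin m) →ₗ[ℝ] _) with hT
  have h : coordMetric g x p = T.transpose * coordMetric g x' p * T := by
    ext a b
    simp only [coordMetric, gram, Matrix.mul_apply, Matrix.of_apply, Matrix.transpose_apply,
      coordField_eq_sum_tangentCoordChange hx hx', ← hT, map_sum, map_smul, LinearMap.sum_apply,
      LinearMap.smul_apply, smul_eq_mul, Finset.mul_sum, Finset.sum_mul]
    exact Finset.sum_congr rfl fun i _ => Finset.sum_congr rfl fun j _ => by ring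
  rw [h, Matrix.det_mul, Matrix.det_mul, Matrix.det_transpose, hT, LinearMap.det_toMatrix,
    ContinuousLinearMap.det]
  ring

theorem sqrt_gramDet_change {x x' : M} {y : EuclideanSpace ℝ (Fin m)}
    (hy : y ∈ (chartAt (EuclideanSpace ℝ (Fin m)) x).target)
    (hy' : (chartAt (EuclideanSpace ℝ (Fin m)) x).symm y ∈
      (chartAt (EuclideanSpace ℝ (Fin m)) x').source) :
    √(gramDet g (chartAt (EuclideanSpace ℝ (Fin m)) x) y) =
      |(tangentCoordChange (𝓡 m) x x' ((chartAt (EuclideanSpace ℝ (Fin m)) x).symm y)).det| *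
        √(gramDet g (chartAt (EuclideanSpace ℝ (Fin m)) x') (chartAt (EuclideanSpace ℝ (Fin m)) x'
          ((chartAt (EuclideanSpace ℝ (Fin m)) x).symm y))) := by
  rw [gramDet_eq_det_coordMetric g hy, gramDet_eq_det_coordMetric g
    ((chartAt (EuclideanSpace ℝ (Fin m)) x').map_source hy'),
    (chartAt (EuclideanSpace ℝ (Fin m)) x').left_inv hy',
    coordMetric_det_change g ((chartAt (EuclideanSpace ℝ (Fin m)) x).map_target hy) hy',
    Real.sqrt_mul (sq_nonneg _), Real.sqrt_sq_eq_abs]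

end ChangeOfCoordinates

/-! ### Chart measures and their gluing. -/

section ChartMeasure

variable [MeasurableSpace M] [BorelSpace M]

theorem aemeasurable_chartAt_symm (x : M) (ν : Measure (EuclideanSpace ℝ (Fin m))) :
    AEMeasurable (chartAt (EuclideanSpace ℝ (Fin m)) x).symm
      (ν.restrict (chartAt (EuclideanSpace ℝ (Fin m)) x).target) :=
  (chartAt (EuclideanSpace ℝ (Fin m)) x).continuousOn_symm.aemeasurable
    (chartAt (EuclideanSpace ℝ (Fin m)) x).open_target.measurableSet

/-- The inverse chart is continuous only on its target, so measurability is taken from its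
restriction to that subtype. -/
theorem measurableSet_chartAt_preimage (x : M) {s : Set M} (hs : MeasurableSet s) :
    MeasurableSet ((chartAt (EuclideanSpace ℝ (Fin m)) x).symm ⁻¹' s ∩
      (chartAt (EuclideanSpace ℝ (Fin m)) x).target) := by
  have ht := (chartAt (EuclideanSpace ℝ (Fin m)) x).open_target.measurableSet
  have hc := continuousOn_iff_continuous_domRestrict.1
    (chartAt (EuclideanSpace ℝ (Fin m)) x).continuousOn_symm
  have := ht.subtype_image (hc.measurable hs)
  convert this using 1
  ext y
  simp only [mem_inter_iff, mem_preimage, mem_image, Subtype.exists, Set.domRestrict_apply]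
  constructor
  · rintro ⟨h1, h2⟩
    exact ⟨y, h2, h1, rfl⟩
  · rintro ⟨z, hz, h1, rfl⟩
    exact ⟨h1, hz⟩

theorem chartMeasure_apply (x : M) {s : Set M} (hs : MeasurableSet s) :
    chartMeasure g (chartAt (EuclideanSpace ℝ (Fin m)) x) s =
      ∫⁻ y in (chartAt (EuclideanSpace ℝ (Fin m)) x).symm ⁻¹' s ∩
        (chartAt (EuclideanSpace ℝ (Fin m)) x).target,
        ENNReal.ofReal √(gramDet g (chartAt (EuclideanSpace ℝ (Fin m)) x) y) := by
  rw [chartMeasure, Measure.map_apply_of_aemeasurable (aemeasurable_chartAt_symm x _) hs,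
    Measure.restrict_apply' (chartAt (EuclideanSpace ℝ (Fin m)) x).open_target.measurableSet,
    withDensity_apply _ (measurableSet_chartAt_preimage x hs)]

theorem chartMeasure_inter_source (x : M) {s : Set M} (hs : MeasurableSet s) :
    chartMeasure g (chartAt (EuclideanSpace ℝ (Fin m)) x)
      (s ∩ (chartAt (EuclideanSpace ℝ (Fin m)) x).source) =
      chartMeasure g (chartAt (EuclideanSpace ℝ (Fin m)) x) s := by
  rw [chartMeasure_apply g x hs, chartMeasure_apply g x
    (hs.inter (chartAt (EuclideanSpace ℝ (Fin m)) x).open_source.measurableSet)]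
  congr 2
  ext y
  simp only [mem_inter_iff, mem_preimage]
  exact ⟨fun h => ⟨h.1.1, h.2⟩, fun h =>
    ⟨⟨h.1, (chartAt (EuclideanSpace ℝ (Fin m)) x).map_target h.2⟩, h.2⟩⟩

/-- The measures of two charts agree on the intersection of their domains. -/
theorem chartMeasure_eq_of_subset {x x' : M} {s : Set M} (hs : MeasurableSet s)
    (hx : s ⊆ (chartAt (EuclideanSpace ℝ (Fin m)) x).source)
    (hx' : s ⊆ (chartAt (EuclideanSpace ℝ (Fin m)) x').source) :
    chartMeasure g (chartAt (EuclideanSpace ℝ (Fin m)) x) s =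
      chartMeasure g (chartAt (EuclideanSpace ℝ (Fin m)) x') s := by
  rw [chartMeasure_apply g x hs, chartMeasure_apply g x' hs]
  set φ := chartAt (EuclideanSpace ℝ (Fin m)) x
  set φ' := chartAt (EuclideanSpace ℝ (Fin m)) x'
  set A := φ.symm ⁻¹' s ∩ φ.target with hA
  have himage : φ'.symm ⁻¹' s ∩ φ'.target = (fun y => φ' (φ.symm y)) '' A := by
    ext z
    constructor
    · rintro ⟨h1, h2⟩
      refine ⟨φ (φ'.symm z), ⟨?_, φ.map_source (hx h1)⟩, ?_⟩
      · rw [mem_preimage, φ.left_inv (hx h1)]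
        exact h1
      · simp only [φ.left_inv (hx h1), φ'.right_inv h2]
    · rintro ⟨y, ⟨h1, h2⟩, rfl⟩
      refine ⟨?_, φ'.map_source (hx' h1)⟩
      rw [mem_preimage, φ'.left_inv (hx' h1)]
      exact h1
  have hinj : InjOn (fun y => φ' (φ.symm y)) A := by
    rintro y ⟨hy, hyt⟩ z ⟨hz, hzt⟩ h
    exact φ.symm.injOn hyt hzt (φ'.injOn (hx' hy) (hx' hz) h)
  have hderiv : ∀ y ∈ A, HasFDerivWithinAt (fun y => φ' (φ.symm y))
      (tangentCoordChange (𝓡 m) x x' (φ.symm y)) A y := by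
    rintro y ⟨hy, hyt⟩
    have h := hasFDerivWithinAt_tangentCoordChange (I := 𝓡 m) (x := x) (y := x')
      (z := φ.symm y) (by simpa using ⟨hx hy, hx' hy⟩)
    have hpt : extChartAt (𝓡 m) x (φ.symm y) = y := by
      simpa using φ.right_inv hyt
    rw [hpt] at h
    exact h.mono (by simp)
  -- Change of variables along the transition map: its Jacobian is exactly the factor relating the
  -- two densities in `sqrt_gramDet_change`.
  rw [himage, lintegral_image_eq_lintegral_abs_det_fderiv_mul volume
    (measurableSet_chartAt_preimage x hs) hderiv hinj]
  refine setLIntegral_congr_fun (measurableSet_chartAt_preimage x hs) ?_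
  rintro y ⟨hy, hyt⟩
  dsimp only
  rw [sqrt_gramDet_change g hyt (hx' hy), ENNReal.ofReal_mul (abs_nonneg _)]

variable [SecondCountableTopology M]

/-- A supremum of measures is hard to evaluate from above. Second countability gives a countable
chart cover; cut into disjoint pieces it yields a glued measure `ν` that dominates every chart
measure and equals that of the chart at `x` on `s`. -/
theorem riemannianMeasure_apply_of_subset (x : M) {s : Set M} (hs : MeasurableSet s)
    (hx : s ⊆ (chartAt (EuclideanSpace ℝ (Fin m)) x).source) :
    riemannianMeasure g s = chartMeasure g (chartAt (EuclideanSpace ℝ (Fin m)) x) s := by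
  obtain ⟨c, hc, hcover⟩ := TopologicalSpace.countable_cover_nhds
    (fun z : M => (chartAt (EuclideanSpace ℝ (Fin m)) z).open_source.mem_nhds
      (mem_chart_source _ z))
  have hne : c.Nonempty := by
    by_contra h
    rw [not_nonempty_iff_eq_empty.1 h] at hcover
    have : x ∈ (univ : Set M) := mem_univ x
    simp [← hcover] at this
  obtain ⟨f, rfl⟩ := hc.exists_eq_range hne
  let A : ℕ → Set M := disjointed fun n => (chartAt (EuclideanSpace ℝ (Fin m)) (f n)).source
  have hAm : ∀ n, MeasurableSet (A n) := fun n => MeasurableSet.disjointed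
    (fun i => (chartAt (EuclideanSpace ℝ (Fin m)) (f i)).open_source.measurableSet) n
  have hAs : ∀ n, A n ⊆ (chartAt (EuclideanSpace ℝ (Fin m)) (f n)).source :=
    disjointed_subset _
  have hAu : ⋃ n, A n = univ := by
    rw [iUnion_disjointed]
    simpa using hcover
  have hsplit : ∀ (ν : Measure M) (t : Set M), MeasurableSet t → ν t = ∑' n, ν (t ∩ A n) := by
    intro ν t ht
    rw [← measure_iUnion (fun i j hij => ((disjoint_disjointed _ hij).mono inter_subset_right
      inter_subset_right)) (fun n => ht.inter (hAm n)), ← inter_iUnion, hAu, inter_univ]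
  let ν : Measure M := Measure.sum fun n =>
    (chartMeasure g (chartAt (EuclideanSpace ℝ (Fin m)) (f n))).restrict (A n)
  have hν : ∀ t, MeasurableSet t → ν t =
      ∑' n, chartMeasure g (chartAt (EuclideanSpace ℝ (Fin m)) (f n)) (t ∩ A n) := by
    intro t ht
    rw [Measure.sum_apply _ ht]
    exact tsum_congr fun n => Measure.restrict_apply ht
  have hle : riemannianMeasure g ≤ ν := by
    refine iSup_le fun z => Measure.le_iff.2 fun t ht => ?_
    rw [hsplit _ t ht, hν t ht]
    refine ENNReal.tsum_le_tsum fun n => ?_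
    have hm := ht.inter (hAm n)
    rw [← chartMeasure_inter_source g z hm, chartMeasure_eq_of_subset g (x' := f n)
      (hm.inter (chartAt (EuclideanSpace ℝ (Fin m)) z).open_source.measurableSet)
      inter_subset_right (fun w hw => hAs n hw.1.2)]
    exact measure_mono inter_subset_left
  refine le_antisymm ?_ ?_
  · refine (hle s).trans (le_of_eq ?_)
    rw [hν s hs, hsplit _ s hs]
    exact tsum_congr fun n => chartMeasure_eq_of_subset g (hs.inter (hAm n))
      (fun w hw => hAs n hw.2) (inter_subset_left.trans hx)
  · exact (le_iSup (fun z => chartMeasure g (chartAt (EuclideanSpace ℝ (Fin m)) z)) x) s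

theorem riemannianMeasure_restrict_source (x : M) :
    (riemannianMeasure g).restrict (chartAt (EuclideanSpace ℝ (Fin m)) x).source =
      chartMeasure g (chartAt (EuclideanSpace ℝ (Fin m)) x) := by
  ext s hs
  rw [Measure.restrict_apply hs, riemannianMeasure_apply_of_subset g x
    (hs.inter (chartAt (EuclideanSpace ℝ (Fin m)) x).open_source.measurableSet)
    inter_subset_right, chartMeasure_inter_source g x hs]

end ChartMeasure
end SubRiem

end

noncomputable section

namespace SubRiem

variable {m : ℕ} {M : Type*} [TopologicalSpace M] [ChartedSpace (EuclideanSpace ℝ (Fin m)) M]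
  [IsManifold (𝓡 m) ∞ M] (g : RiemannianMetricOn m M)
  [MeasurableSpace M] [BorelSpace M] [SecondCountableTopology M]

/-! ### Properties of the Riemannian measure. -/

section RiemannianMeasure

theorem isLocallyFiniteMeasure_riemannianMeasure :
    IsLocallyFiniteMeasure (riemannianMeasure g) := by
  refine ⟨fun x => ?_⟩
  set φ := chartAt (EuclideanSpace ℝ (Fin m)) x with hφ
  obtain ⟨K, hK, hxK, hKt⟩ := exists_compact_subset φ.open_target
    (φ.map_source (mem_chart_source _ x))
  have hUo : IsOpen (φ.source ∩ φ ⁻¹' interior K) :=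
    φ.isOpen_inter_preimage isOpen_interior
  refine ⟨_, hUo.mem_nhds ⟨mem_chart_source _ x, hxK⟩, ?_⟩
  rw [riemannianMeasure_apply_of_subset g x hUo.measurableSet inter_subset_left,
    chartMeasure_apply g x hUo.measurableSet]
  have hint : IntegrableOn (fun y => √(gramDet g φ y)) K :=
    ((contDiffOn_sqrt_gramDet g).continuousOn.mono hKt).integrableOn_compact hK
  refine lt_of_le_of_lt (lintegral_mono_set ?_)
    (hasFiniteIntegral_iff_ofReal (Eventually.of_forall fun y => Real.sqrt_nonneg _) |>.1 hint.2)
  rintro y ⟨⟨-, hy⟩, hyt⟩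
  rw [mem_preimage, φ.right_inv hyt] at hy
  exact interior_subset hy

/-- The density is positive throughout the chart target. This is what later turns almost everywhere
vanishing of a continuous function into vanishing. -/
theorem isOpenPosMeasure_riemannianMeasure : (riemannianMeasure g).IsOpenPosMeasure := by
  refine ⟨fun U hU ⟨x, hx⟩ h0 => ?_⟩
  set φ := chartAt (EuclideanSpace ℝ (Fin m)) x with hφ
  have h1 : chartMeasure g φ U = 0 :=
    le_antisymm ((le_iSup (fun z => chartMeasure g (chartAt (EuclideanSpace ℝ (Fin m)) z)) x
      U).trans h0.le) zero_le
  rw [chartMeasure_apply g x hU.measurableSet, inter_comm] at h1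
  have hAo : IsOpen (φ.target ∩ φ.symm ⁻¹' U) := φ.symm.isOpen_inter_preimage hU
  have hm : AEMeasurable (fun y => ENNReal.ofReal √(gramDet g φ y))
      (volume.restrict (φ.target ∩ φ.symm ⁻¹' U)) :=
    (((contDiffOn_sqrt_gramDet g).continuousOn.mono inter_subset_left).aemeasurable
      hAo.measurableSet).ennreal_ofReal
  rw [lintegral_eq_zero_iff' hm] at h1
  have h2 : volume (φ.target ∩ φ.symm ⁻¹' U) = 0 := by
    have h3 := (ae_restrict_iff' hAo.measurableSet).1 h1
    refine measure_mono_null (fun y hy => ?_) h3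
    intro h4
    have h5 := h4 hy
    simp only [Pi.zero_apply, ENNReal.ofReal_eq_zero] at h5
    exact absurd (Real.sqrt_pos.2 (gramDet_chartAt_pos g hy.1)) (not_lt.2 h5)
  refine hAo.measure_ne_zero volume ⟨φ x, φ.map_source (mem_chart_source _ x), ?_⟩ h2
  rw [mem_preimage, φ.left_inv (mem_chart_source _ x)]
  exact hx

/-- Integration against the Riemannian measure in a chart. -/
theorem integral_riemannianMeasure_eq {H : M → ℝ} (hH : Continuous H) (x : M)
    (hsupp : ∀ z ∉ (chartAt (EuclideanSpace ℝ (Fin m)) x).source, H z = 0) :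
    ∫ z, H z ∂riemannianMeasure g =
      ∫ y in (chartAt (EuclideanSpace ℝ (Fin m)) x).target,
        √(gramDet g (chartAt (EuclideanSpace ℝ (Fin m)) x) y) *
          H ((chartAt (EuclideanSpace ℝ (Fin m)) x).symm y) := by
  set φ := chartAt (EuclideanSpace ℝ (Fin m)) x with hφ
  have hm : AEMeasurable (fun y => ENNReal.ofReal √(gramDet g φ y))
      (volume.restrict φ.target) :=
    ((contDiffOn_sqrt_gramDet g).continuousOn.aemeasurable
      φ.open_target.measurableSet).ennreal_ofReal
  rw [← setIntegral_eq_integral_of_forall_compl_eq_zero hsupp,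
    riemannianMeasure_restrict_source g x, chartMeasure,
    integral_map (aemeasurable_chartAt_symm x _) hH.aestronglyMeasurable,
    restrict_withDensity φ.open_target.measurableSet,
    integral_withDensity_eq_integral_toReal_smul₀ hm (by simp)]
  simp [ENNReal.toReal_ofReal (Real.sqrt_nonneg _)]
  rfl

end RiemannianMeasure

/-! ### The divergence theorem inside one chart. -/

section IntegrationByParts

/-- Integration by parts against the constant function 1. -/
theorem integral_fderiv_eq_zero {F : EuclideanSpace ℝ (Fin m) → ℝ} (hF : ContDiff ℝ ∞ F)
    (hc : HasCompactSupport F) (v : EuclideanSpace ℝ (Fin m)) :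
    ∫ y, fderiv ℝ F y v = 0 := by
  have hi : Integrable (fun y => fderiv ℝ F y v) :=
    ((hF.continuous_fderiv (by simp)).clm_apply continuous_const).integrable_of_hasCompactSupport
      (hc.fderiv_apply ℝ v)
  have h := integral_mul_fderiv_eq_neg_fderiv_mul_of_integrable (μ := volume)
    (f := fun _ : EuclideanSpace ℝ (Fin m) => (1 : ℝ)) (g := F) (v := v)
    (by simp) (by simpa using hi)
    (by simpa using hF.continuous.integrable_of_hasCompactSupport hc)
    (fun _ _ => differentiableAt_const _) (fun y _ => hF.differentiable (by simp) y)
  simpa using h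

theorem integral_mul_riemannianDivergence_add_of_chart [T2Space M] {h : M → ℝ}
    {Y : ∀ x : M, TangentSpace (𝓡 m) x} (hY : SmoothFieldOn Y univ)
    (hdiv : Continuous (riemannianDivergence g Y))
    (hh : ContMDiff (𝓡 m) 𝓘(ℝ, ℝ) ∞ h) (hc : HasCompactSupport h) (x₀ : M)
    (hsupp : tsupport h ⊆ (chartAt (EuclideanSpace ℝ (Fin m)) x₀).source) :
    ∫ x, (h x * riemannianDivergence g Y x + mvfderiv (𝓡 m) h x (Y x)) ∂riemannianMeasure g
      = 0 := by
  set φ := chartAt (EuclideanSpace ℝ (Fin m)) x₀ with hφ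
  have hcont : Continuous fun x =>
      h x * riemannianDivergence g Y x + mvfderiv (𝓡 m) h x (Y x) :=
    (hh.continuous.mul hdiv).add (continuousOn_univ.1
      (hY.contMDiffOn_mvfderiv isOpen_univ hh.contMDiffOn).continuousOn)
  rw [integral_riemannianMeasure_eq g hcont x₀ fun z hz => by
    have hz' : z ∉ tsupport h := fun h' => hz (hsupp h')
    rw [mvfderiv_eq_zero_of_notMem_tsupport hz', image_eq_zero_of_notMem_tsupport hz']
    simp]
  set K := φ '' tsupport h with hKdef
  have hK : IsCompact K := IsCompact.image_of_continuousOn hc (φ.continuousOn.mono hsupp)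
  have hKt : K ⊆ φ.target := by
    rintro _ ⟨z, hz, rfl⟩
    exact φ.map_source (hsupp hz)
  let P : Fin m → EuclideanSpace ℝ (Fin m) → ℝ := fun c y =>
    √(gramDet g φ y) * coordCoeff x₀ Y c (φ.symm y)
  have hP : ∀ c, ContDiffOn ℝ ∞ (P c) φ.target := fun c =>
    (contDiffOn_sqrt_gramDet g).mul (contDiffOn_comp_chartAt_symm (hY.contMDiffOn_coordCoeff c))
  have hhs : ContDiffOn ℝ ∞ (fun y => h (φ.symm y)) φ.target :=
    contDiffOn_comp_chartAt_symm hh.contMDiffOn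
  -- Off the target the inverse chart has no meaning, so the product is set to 0 there. No
  -- smoothness is lost, as it already vanishes off the compact `K` inside the open target.
  let F : Fin m → EuclideanSpace ℝ (Fin m) → ℝ := fun c =>
    φ.target.indicator fun y => h (φ.symm y) * P c y
  have hF0 : ∀ c, ∀ y ∉ K, F c y = 0 := by
    intro c y hy
    by_cases hyt : y ∈ φ.target
    · have : φ.symm y ∉ tsupport h := fun h' => hy ⟨_, h', φ.right_inv hyt⟩
      simp [F, hyt, image_eq_zero_of_notMem_tsupport this]
    · simp [F, hyt]
  have hFt : ∀ c, ∀ y ∈ φ.target, F c =ᶠ[𝓝 y] fun y => h (φ.symm y) * P c y := by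
    intro c y hy
    filter_upwards [φ.open_target.mem_nhds hy] with z hz
    simp [F, hz]
  have hFK : ∀ c, ∀ y ∉ K, F c =ᶠ[𝓝 y] fun _ => 0 := by
    intro c y hy
    filter_upwards [hK.isClosed.isOpen_compl.mem_nhds hy] with z hz
    exact hF0 c z hz
  have hF : ∀ c, ContDiff ℝ ∞ (F c) := fun c => contDiff_iff_contDiffAt.2 fun y => by
    by_cases hy : y ∈ φ.target
    · exact ((hhs.mul (hP c)).contDiffAt (φ.open_target.mem_nhds hy)).congr_of_eventuallyEq
        (hFt c y hy)
    · exact contDiffAt_const.congr_of_eventuallyEq (hFK c y fun h' => hy (hKt h'))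
  have hFc : ∀ c, HasCompactSupport (F c) := fun c => HasCompactSupport.intro hK (hF0 c)
  have hpt : ∀ y ∈ φ.target, √(gramDet g φ y) * (h (φ.symm y) *
      riemannianDivergence g Y (φ.symm y) + mvfderiv (𝓡 m) h (φ.symm y) (Y (φ.symm y))) =
      ∑ c, fderiv ℝ (F c) y (EuclideanSpace.single c 1) := by
    intro y hy
    have htn := φ.open_target.mem_nhds hy
    have hd : ∀ c, fderiv ℝ (F c) y (EuclideanSpace.single c 1) =
        h (φ.symm y) * fderiv ℝ (P c) y (EuclideanSpace.single c 1) +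
          √(gramDet g φ y) * (coordCoeff x₀ Y c (φ.symm y) *
            mvfderiv (𝓡 m) h (φ.symm y) (coordField x₀ c (φ.symm y))) := by
      intro c
      rw [(hFt c y hy).fderiv_eq, fderiv_fun_mul
        ((hhs.contDiffAt htn).differentiableAt (by simp))
        (((hP c).contDiffAt htn).differentiableAt (by simp))]
      simp only [add_apply, smul_apply, smul_eq_mul]
      rw [fderiv_comp_chartAt_symm hy (hh.mdifferentiable (by simp) _)]
      simp only [P]
      ring
    simp only [hd]
    rw [Finset.sum_add_distrib, ← Finset.mul_sum, ← Finset.mul_sum,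
      ← sqrt_gramDet_mul_riemannianDivergence g hY hy]
    have hYx : mvfderiv (𝓡 m) h (φ.symm y) (Y (φ.symm y)) = ∑ c, coordCoeff x₀ Y c (φ.symm y) *
        mvfderiv (𝓡 m) h (φ.symm y) (coordField x₀ c (φ.symm y)) := by
      conv_lhs => rw [eq_sum_coordCoeff (x₀ := x₀) Y (φ.map_target hy)]
      simp only [map_sum, map_smul, smul_eq_mul]
    rw [hYx]
    ring
  rw [setIntegral_congr_fun φ.open_target.measurableSet hpt,
    setIntegral_eq_integral_of_forall_compl_eq_zero fun y hy => by
      refine Finset.sum_eq_zero fun c _ => ?_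
      rw [(hFK c y fun h' => hy (hKt h')).fderiv_eq]
      simp,
    integral_finsetSum]
  · exact Finset.sum_eq_zero fun c _ => integral_fderiv_eq_zero (hF c) (hFc c) _
  · intro c _
    exact (((hF c).continuous_fderiv (by simp)).clm_apply
      continuous_const).integrable_of_hasCompactSupport ((hFc c).fderiv_apply ℝ _)

end IntegrationByParts
end SubRiem

end

noncomputable section

namespace SubRiem

variable {m : ℕ} {M : Type*} [TopologicalSpace M] [ChartedSpace (EuclideanSpace ℝ (Fin m)) M]
  [IsManifold (𝓡 m) ∞ M]

/-! ### The divergence theorem on the manifold. -/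

section DivergenceTheorem

theorem sigmaCompactSpace (m : ℕ) (M : Type*) [TopologicalSpace M]
    [ChartedSpace (EuclideanSpace ℝ (Fin m)) M] [SecondCountableTopology M] :
    SigmaCompactSpace M := by
  have := ChartedSpace.locallyCompactSpace (EuclideanSpace ℝ (Fin m)) M
  infer_instance

theorem SmoothFieldOn.continuous_mvfderiv {f : M → ℝ} {Y : ∀ x : M, TangentSpace (𝓡 m) x}
    (hY : SmoothFieldOn Y univ) (hf : ContMDiff (𝓡 m) 𝓘(ℝ, ℝ) ∞ f) :
    Continuous fun x => mvfderiv (𝓡 m) f x (Y x) :=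
  continuousOn_univ.1 (hY.contMDiffOn_mvfderiv isOpen_univ hf.contMDiffOn).continuousOn

variable [T2Space M] [MeasurableSpace M] [BorelSpace M] [SecondCountableTopology M]

/-- The divergence theorem: for a smooth vector field `Y` and a smooth function `h` with compact
support, `∫ div(hY) dvol = 0`. -/
theorem integral_mul_riemannianDivergence_add (g : RiemannianMetricOn m M) {h : M → ℝ}
    {Y : ∀ x : M, TangentSpace (𝓡 m) x} (hY : SmoothFieldOn Y univ)
    (hdiv : Continuous (riemannianDivergence g Y))
    (hh : ContMDiff (𝓡 m) 𝓘(ℝ, ℝ) ∞ h) (hc : HasCompactSupport h) :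
    ∫ x, (h x * riemannianDivergence g Y x + mvfderiv (𝓡 m) h x (Y x)) ∂riemannianMeasure g
      = 0 := by
  have := isLocallyFiniteMeasure_riemannianMeasure g
  have := sigmaCompactSpace m M
  have hint : ∀ {h : M → ℝ}, ContMDiff (𝓡 m) 𝓘(ℝ, ℝ) ∞ h → HasCompactSupport h →
      Integrable (fun x => h x * riemannianDivergence g Y x + mvfderiv (𝓡 m) h x (Y x))
        (riemannianMeasure g) := fun {h} hh hc =>
    ((hh.continuous.mul hdiv).add
      (hY.continuous_mvfderiv hh)).integrable_of_hasCompactSupport <|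
      HasCompactSupport.intro hc fun x hx => by
        change h x * riemannianDivergence g Y x + mvfderiv (𝓡 m) h x (Y x) = 0
        rw [mvfderiv_eq_zero_of_notMem_tsupport hx, image_eq_zero_of_notMem_tsupport hx]
        simp
  obtain ⟨ρ, hρ⟩ := SmoothPartitionOfUnity.exists_isSubordinate_chartAt_source (𝓡 m) M
  have hρh : ∀ i, ContMDiff (𝓡 m) 𝓘(ℝ, ℝ) ∞ fun x => ρ i x * h x := fun i =>
    (ρ i).contMDiff.mul hh
  have hρc : ∀ i, HasCompactSupport fun x => ρ i x * h x := fun i => hc.mul_left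
  -- Smoothness and compact support travel through the induction because they give the integrability
  -- that additivity of the integral requires.
  have hsum : ∀ T : Finset M, ContMDiff (𝓡 m) 𝓘(ℝ, ℝ) ∞ (fun x => ∑ i ∈ T, ρ i x * h x) ∧
      HasCompactSupport (fun x => ∑ i ∈ T, ρ i x * h x) ∧
      ∫ x, ((∑ i ∈ T, ρ i x * h x) * riemannianDivergence g Y x +
        mvfderiv (𝓡 m) (fun x => ∑ i ∈ T, ρ i x * h x) x (Y x)) ∂riemannianMeasure g = 0 := by
    classical
    intro T
    induction T using Finset.induction_on with
    | empty => exact ⟨by simpa using contMDiff_const, by simpa using! HasCompactSupport.zero,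
        by simp [mvfderiv_const]⟩
    | insert i T hi ih =>
      obtain ⟨h1, h2, h3⟩ := ih
      simp only [Finset.sum_insert hi]
      refine ⟨(hρh i).add h1, (hρc i).add h2, ?_⟩
      have h4 := integral_mul_riemannianDivergence_add_of_chart g hY hdiv (hρh i) (hρc i) i
        ((tsupport_mul_subset_left (f := ρ i) (g := h)).trans (hρ i))
      rw [← add_zero (0 : ℝ)]
      nth_rw 1 [← h4]
      rw [← h3, ← integral_add (hint (hρh i) (hρc i)) (hint h1 h2)]
      refine integral_congr_ae (Eventually.of_forall fun x => ?_)
      have h5 := mvfderiv_fun_add ((hρh i).mdifferentiable (by simp) x)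
        (h1.mdifferentiable (by simp) x)
      simp only [h5, add_apply]
      ring
  -- Only finitely many members of the partition meet the compact support, so `h` is one of these
  -- finite sums.
  have hfin := ρ.locallyFinite.finite_nonempty_inter_compact hc
  have heq : h = fun x => ∑ i ∈ hfin.toFinset, ρ i x * h x := by
    funext x
    rw [← Finset.sum_mul]
    by_cases hx : x ∈ tsupport h
    · have h1 := ρ.sum_eq_one (mem_univ x)
      rw [finsum_eq_sum_of_support_subset] at h1
      · rw [h1, one_mul]
      · intro i hi
        simp only [Finite.coe_toFinset, mem_ofPred_eq]
        exact ⟨x, hi, hx⟩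
    · simp [image_eq_zero_of_notMem_tsupport hx]
  have h6 := (hsum hfin.toFinset).2.2
  simpa only [← heq, ← fun x => congrFun heq x] using h6

end DivergenceTheorem

/-! ### Test functions separate tangent vectors. -/

section TestFunctions

variable [T2Space M]

/-- A tangent vector that annihilates all smooth functions with compact support vanishes. -/
theorem eq_zero_of_forall_mvfderiv_eq_zero {x : M} {w : TangentSpace (𝓡 m) x}
    (hw : ∀ e : M → ℝ, ContMDiff (𝓡 m) 𝓘(ℝ, ℝ) ∞ e → HasCompactSupport e →
      mvfderiv (𝓡 m) e x w = 0) : w = 0 := by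
  obtain ⟨ψ⟩ : Nonempty (SmoothBumpFunction (𝓡 m) x) := inferInstance
  -- The test function is a bump times the inner product with `w` in the chart at `x`. That chart
  -- has identity derivative at its own centre, so the derivative along `w` is `|w|²`.
  let w' : EuclideanSpace ℝ (Fin m) := w
  let L : EuclideanSpace ℝ (Fin m) →L[ℝ] ℝ := innerSL ℝ w'
  have he : ContMDiff (𝓡 m) 𝓘(ℝ, ℝ) ∞ fun y => ψ y • L (extChartAt (𝓡 m) x y) :=
    ψ.contMDiff_smul (L.contMDiff.comp_contMDiffOn (contMDiffOn_extChartAt (n := ∞)))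
  have h := hw _ he ψ.hasCompactSupport.smul_right
  have hev : (fun y => ψ y • L (extChartAt (𝓡 m) x y)) =ᶠ[𝓝 x]
      L ∘ extChartAt (𝓡 m) x := by
    filter_upwards [ψ.eventuallyEq_one] with y hy
    simp [hy]
  have h1 : mfderiv (𝓡 m) 𝓘(ℝ, ℝ) (L ∘ extChartAt (𝓡 m) x) x w = 0 :=
    (congrArg (fun A : EuclideanSpace ℝ (Fin m) →L[ℝ] ℝ => A w') hev.mfderiv_eq).symm.trans h
  rw [mfderiv_comp_apply x L.differentiableAt.mdifferentiableAt
    (mdifferentiableAt_extChartAt (mem_chart_source _ x)), mfderiv_eq_fderiv, L.fderiv] at h1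
  have h2 : mfderiv (𝓡 m) (𝓡 m) (extChartAt (𝓡 m) x) x w = w' :=
    congrArg (fun A : EuclideanSpace ℝ (Fin m) →L[ℝ] EuclideanSpace ℝ (Fin m) => A w')
      (mfderiv_extChartAt_self (I := 𝓡 m) (x := x))
  have h3 : inner ℝ w' w' = 0 := (congrArg L h2).symm.trans h1
  exact inner_self_eq_zero.1 h3

end TestFunctions

/-! ### Green's formula for the horizontal Laplacian. -/

section Green

variable {k l : ℕ} {S : SubRiemannianStructure m M k} {S' : Distribution m M l}
  (hS : IsSplitting S.toDistribution S') {g : RiemannianMetricOn m M}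

theorem IsOrthogonalExtension.smoothFieldOn_horizontalGradient
    (hg : IsOrthogonalExtension S S' g) {f : M → ℝ} (hf : ContMDiff (𝓡 m) 𝓘(ℝ, ℝ) ∞ f) :
    SmoothFieldOn (fun y => (horizontalGradient S f y : TangentSpace (𝓡 m) y)) univ :=
  smoothFieldOn_of_forall_smoothFieldAt fun x _ => hg.smoothFieldAt_horizontalGradient hf x

theorem IsOrthogonalExtension.continuous_horizontalLaplacian (hg : IsOrthogonalExtension S S' g)
    {f : M → ℝ} (hf : ContMDiff (𝓡 m) 𝓘(ℝ, ℝ) ∞ f) : Continuous (horizontalLaplacian hS f) := by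
  have h := continuous_sum_lieForm g S.toDistribution (hg.smoothFieldOn_horizontalGradient hf)
    (horizontalBasis S) fun y i j => by
      rw [hg.extends_gc, horizontalBasis, orthonormalBasis_apply]
  exact (continuous_const.mul h).congr fun x => (hg.horizontalDivergence_eq hS _ x).symm

/-- Regularity of the mean curvature itself is never needed: its pairing with a gradient is minus
half a trace over `S'`. -/
theorem IsOrthogonalExtension.continuous_gc_meanCurvature (hg : IsOrthogonalExtension S S' g)
    {f : M → ℝ} (hf : ContMDiff (𝓡 m) 𝓘(ℝ, ℝ) ∞ f) :
    Continuous fun x => S.gc x (meanCurvature hS g x) (horizontalGradient S f x) := by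
  have h := continuous_sum_lieForm g S' (hg.smoothFieldOn_horizontalGradient hf)
    (fun x => orthonormalBasis (metricForm_restrict_isInner g x (S'.fiber x))) fun y i j => by
      have := orthonormalBasis_apply (metricForm_restrict_isInner g y (S'.fiber y)) i j
      simpa using this
  exact (continuous_const.mul h).neg.congr fun x =>
    (hg.gc_meanCurvature hS (hg.smoothFieldAt_horizontalGradient hf x).diffFieldAt).symm

theorem IsOrthogonalExtension.continuous_gc_horizontalGradient
    (hg : IsOrthogonalExtension S S' g) {e f : M → ℝ} (he : ContMDiff (𝓡 m) 𝓘(ℝ, ℝ) ∞ e)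
    (hf : ContMDiff (𝓡 m) 𝓘(ℝ, ℝ) ∞ f) :
    Continuous fun x => S.gc x (horizontalGradient S e x) (horizontalGradient S f x) := by
  simp only [gc_horizontalGradient]
  exact (hg.smoothFieldOn_horizontalGradient hf).continuous_mvfderiv he

theorem gc_horizontalGradient_log {u : M → ℝ} (hu : ContMDiff (𝓡 m) 𝓘(ℝ, ℝ) ∞ u) {x : M}
    (hx : 0 < u x) (v : S.fiber x) :
    u x * S.gc x (horizontalGradient S (fun y => Real.log (u y)) x) v =
      mvfderiv (𝓡 m) u x v := by
  rw [gc_horizontalGradient]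
  have h1 : mfderiv (𝓡 m) 𝓘(ℝ, ℝ) (Real.log ∘ u) x (v : TangentSpace (𝓡 m) x) =
      mfderiv 𝓘(ℝ, ℝ) 𝓘(ℝ, ℝ) Real.log (u x) (mfderiv (𝓡 m) 𝓘(ℝ, ℝ) u x v) :=
    mfderiv_comp_apply x (Real.differentiableAt_log hx.ne').mdifferentiableAt
      (hu.mdifferentiable (by simp) x) _
  have h2 : mvfderiv (𝓡 m) (fun y => Real.log (u y)) x (v : TangentSpace (𝓡 m) x) =
      mvfderiv (𝓡 m) u x v * (u x)⁻¹ := by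
    rw [mfderiv_eq_fderiv, (Real.hasDerivAt_log hx.ne').hasFDerivAt.fderiv] at h1
    exact h1
  rw [h2]
  field_simp

theorem IsOrthogonalExtension.continuous_mul_gc_log_sub
    (hg : IsOrthogonalExtension S S' g) {u e : M → ℝ}
    (hu : ContMDiff (𝓡 m) 𝓘(ℝ, ℝ) ∞ u) (hu_pos : ∀ x, 0 < u x)
    (he : ContMDiff (𝓡 m) 𝓘(ℝ, ℝ) ∞ e) : Continuous fun x =>
      u x * S.gc x (horizontalGradient S (fun y => Real.log (u y)) x -
        meanCurvature hS g x) (horizontalGradient S e x) := by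
  refine (((hg.smoothFieldOn_horizontalGradient he).continuous_mvfderiv hu).sub
    (hu.continuous.mul (hg.continuous_gc_meanCurvature hS he))).congr fun x => ?_
  rw [map_sub, LinearMap.sub_apply, mul_sub, gc_horizontalGradient_log hu (hu_pos x)]
  rfl

variable [T2Space M] [MeasurableSpace M] [BorelSpace M] [SecondCountableTopology M]

/-- Green's formula for the horizontal Laplacian and the measure `u dvol`, with the error term
given by the difference of `∇ᴴ(log u)` and the mean curvature. -/
theorem IsOrthogonalExtension.integral_horizontalLaplacian_mul_add
    (hg : IsOrthogonalExtension S S' g) {u e f : M → ℝ}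
    (hu : ContMDiff (𝓡 m) 𝓘(ℝ, ℝ) ∞ u) (hu_pos : ∀ x, 0 < u x)
    (he : ContMDiff (𝓡 m) 𝓘(ℝ, ℝ) ∞ e)
    (hf : ContMDiff (𝓡 m) 𝓘(ℝ, ℝ) ∞ f) (hfc : HasCompactSupport f) :
    ∫ x, horizontalLaplacian hS e x * f x
        ∂((riemannianMeasure g).withDensity fun x => ENNReal.ofReal (u x)) +
      ∫ x, S.gc x (horizontalGradient S e x) (horizontalGradient S f x)
        ∂((riemannianMeasure g).withDensity fun x => ENNReal.ofReal (u x)) =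
      -∫ x, f x • (u x * S.gc x (horizontalGradient S (fun y => Real.log (u y)) x -
        meanCurvature hS g x) (horizontalGradient S e x)) ∂riemannianMeasure g := by
  have := isLocallyFiniteMeasure_riemannianMeasure g
  have hY := hg.smoothFieldOn_horizontalGradient he
  have hdiv_eq : ∀ x, riemannianDivergence g
      (fun y => (horizontalGradient S e y : TangentSpace (𝓡 m) y)) x =
      horizontalLaplacian hS e x -
        S.gc x (meanCurvature hS g x) (horizontalGradient S e x) := fun x =>
    hg.riemannianDivergence_eq hS (hg.smoothFieldAt_horizontalGradient he x).diffFieldAt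
  have hdiv : Continuous (riemannianDivergence g
      (fun y => (horizontalGradient S e y : TangentSpace (𝓡 m) y))) :=
    ((hg.continuous_horizontalLaplacian hS he).sub
      (hg.continuous_gc_meanCurvature hS he)).congr fun x => (hdiv_eq x).symm
  -- The weight `u` goes into the test function, so this is the integral of `div(f u ∇^H e)`.
  have key := integral_mul_riemannianDivergence_add g hY hdiv (hf.mul hu) hfc.mul_right
  have hm : Measurable fun x => ENNReal.ofReal (u x) := hu.continuous.measurable.ennreal_ofReal
  rw [integral_withDensity_eq_integral_toReal_smul hm (by simp),
    integral_withDensity_eq_integral_toReal_smul hm (by simp)]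
  simp only [ENNReal.toReal_ofReal (hu_pos _).le, smul_eq_mul]
  have hgc0 : ∀ x ∉ tsupport f,
      S.gc x (horizontalGradient S e x) (horizontalGradient S f x) = 0 := fun x hx => by
    rw [(S.isInner_gc x).symm, gc_horizontalGradient, mvfderiv_eq_zero_of_notMem_tsupport hx]
    simp
  have hi1 : Integrable (fun x => u x * (horizontalLaplacian hS e x * f x))
      (riemannianMeasure g) :=
    (hu.continuous.mul ((hg.continuous_horizontalLaplacian hS he).mul
      hf.continuous)).integrable_of_hasCompactSupport (hfc.mul_left.mul_left)
  have hi2 : Integrable (fun x => u x *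
      S.gc x (horizontalGradient S e x) (horizontalGradient S f x)) (riemannianMeasure g) :=
    (hu.continuous.mul
      (hg.continuous_gc_horizontalGradient he hf)).integrable_of_hasCompactSupport
      (HasCompactSupport.intro hfc fun x hx => by
        simp [hgc0 x hx])
  have hi3 : Integrable (fun x => f x * (u x * S.gc x (horizontalGradient S
      (fun y => Real.log (u y)) x - meanCurvature hS g x) (horizontalGradient S e x)))
      (riemannianMeasure g) :=
    (hf.continuous.mul
      (hg.continuous_mul_gc_log_sub hS hu hu_pos he)).integrable_of_hasCompactSupport hfc.mul_right
  rw [eq_neg_iff_add_eq_zero, ← integral_add hi1 hi2, ← integral_add (hi1.fun_add hi2) hi3, ← key]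
  refine integral_congr_ae (Eventually.of_forall fun x => ?_)
  have hmul := mvfderiv_mul (hf.mdifferentiable (by simp) x) (hu.mdifferentiable (by simp) x)
  have h1 := gc_horizontalGradient_log (S := S) hu (hu_pos x) (horizontalGradient S e x)
  have h2 : S.gc x (horizontalGradient S e x) (horizontalGradient S f x) =
      mvfderiv (𝓡 m) f x (horizontalGradient S e x) := by
    rw [(S.isInner_gc x).symm, gc_horizontalGradient]
  change u x * (horizontalLaplacian hS e x * f x) + u x * _ + f x * (u x * _) =
    f x * u x * _ + mvfderiv (𝓡 m) (f * u) x _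
  rw [hmul, hdiv_eq, h2, map_sub, LinearMap.sub_apply]
  simp only [add_apply, smul_apply, smul_eq_mul]
  rw [← h1]
  ring

end Green

end SubRiem

end

/-! ### The equivalence. -/

theorem theorem1p2 {m k l : ℕ} {M : Type*} [TopologicalSpace M] [T2Space M]
    [SecondCountableTopology M] [ChartedSpace (EuclideanSpace ℝ (Fin m)) M]
    [IsManifold (𝓡 m) ∞ M] [MeasurableSpace M] [BorelSpace M]
    (S : SubRiem.SubRiemannianStructure m M k) (S' : SubRiem.Distribution m M l)
    (hS : SubRiem.IsSplitting S.toDistribution S')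
    (g : SubRiem.RiemannianMetricOn m M) (hg : SubRiem.IsOrthogonalExtension S S' g)
    (u : M → ℝ) (hu : ContMDiff (𝓡 m) 𝓘(ℝ, ℝ) ∞ u) (hu_pos : ∀ x, 0 < u x)
    (μ : Measure M)
    (hμ : μ = (SubRiem.riemannianMeasure g).withDensity fun x => ENNReal.ofReal (u x)) :
    (∀ e f : M → ℝ,
        ContMDiff (𝓡 m) 𝓘(ℝ, ℝ) ∞ e → HasCompactSupport e →
        ContMDiff (𝓡 m) 𝓘(ℝ, ℝ) ∞ f → HasCompactSupport f →
        -∫ x, SubRiem.horizontalLaplacian hS e x * f x ∂μ =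
          ∫ x, S.gc x (SubRiem.horizontalGradient S e x) (SubRiem.horizontalGradient S f x) ∂μ) ↔
      ∀ x, SubRiem.horizontalGradient S (fun y => Real.log (u y)) x =
        SubRiem.meanCurvature hS g x := by
  subst hμ
  have green := fun e f he (hf : ContMDiff (𝓡 m) 𝓘(ℝ, ℝ) ∞ f) hfc =>
    hg.integral_horizontalLaplacian_mul_add hS (e := e) (f := f) hu hu_pos he hf hfc
  constructor
  · intro H x
    have := SubRiem.isLocallyFiniteMeasure_riemannianMeasure g
    have := SubRiem.isOpenPosMeasure_riemannianMeasure g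
    have := SubRiem.sigmaCompactSpace m M
    -- The difference is regarded as a vector of the full tangent space, to be tested against
    -- differentials of compactly supported `e`.
    rw [← sub_eq_zero, ← Submodule.coe_eq_zero]
    refine SubRiem.eq_zero_of_forall_mvfderiv_eq_zero fun e he hec => ?_
    have hcont := hg.continuous_mul_gc_log_sub hS hu hu_pos he
    -- For fixed `e`, the hypothesis makes the error term of Green's formula vanish for every test
    -- function `f`.
    have hae := ae_eq_zero_of_integral_contMDiff_smul_eq_zero (𝓡 m)
      (μ := SubRiem.riemannianMeasure g) hcont.locallyIntegrable fun f hf hfc => by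
        have h1 := green e f he hf hfc
        have h2 := H e f he hec hf hfc
        linarith
    have hzero := congrFun ((hcont.ae_eq_iff_eq (SubRiem.riemannianMeasure g)
      continuous_const).1 hae) x
    -- On a horizontal vector, `de` is the pairing with `∇^H e`; the positive factor `u x` is then
    -- cancelled.
    rw [← SubRiem.gc_horizontalGradient, (S.isInner_gc x).symm]
    exact (mul_eq_zero.1 hzero).resolve_left (hu_pos x).ne'
  · intro H e f he _ hf hfc
    have h1 := green e f he hf hfc
    simp only [H, sub_self, map_zero, LinearMap.zero_apply, mul_zero, smul_zero,
      integral_zero, neg_zero] at h1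
    linarith
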